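/- **Model.** Time is slotted, $t_0,t_1,t_2,\dots$; slot $k$ lasts from $t_k$ to $t_{k+1}$. Tasks are generated by a discrete-time Markovian arrival process (D-MAP) $(D_0,D_1)$ with phases $\{1,\dots,m\}$: $D_0,D_1$ are nonnegative and nonzero, $D=D_0+D_1$ is stochastic, and $(D_0)_{ij}$ (resp. $(D_1)_{ij}$) is the probability of a phase change from $i$ to $j$ in a slot without (resp. with) a generated task; the average arrival rate is positive, i.e. $\pi D_1\mathbf e>0$ for every stationary distribution $\pi$ of $D$. Transmission times, computation times and vacation durations are mutually independent and discrete phase-type distributed on $\{1,2,\dots\}$ with representations $(\beta_1,S_1)$, $(\beta_2,S_2)$, $(v,V)$ (initial probability vector; substochastic matrix $T$ with $I-T$ nonsingular; exit vector $T^0=\mathbf e-T\mathbf e$). Queues 1 and 2 are FIFO single-server queues with capacities $1\le N_1<N_2<\infty$ (task in service included). A task generated in a slot enters queue 1 at the end of the slot if queue 1 holds fewer than $N_1$ tasks or a transmission completes in that slot; otherwise it is rejected. A transmitted task moves to queue 2, whose server works whenever queue 2 is nonempty; a task leaves the system when its computation completes. Whenever a transmission completes, a vacation expires, or a task enters an empty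 queue 1, server 1 becomes idle if queue 1 is then empty, starts a transmission if queue 1 is nonempty and queue 2 is not full, and starts a vacation if queue 1 is nonempty and queue 2 is full (queue lengths at the end of the slot). Let $\Xi$ be the resulting Markov chain of the states $(i_1,i_2,\varphi)$ at the times $t_k$, where $i_1,i_2$ are the queue lengths and $\varphi$ collects the D-MAP phase, the transmission or vacation phase of server 1 (if $i_1\ge1$) and the computation phase of server 2 (if $i_2\ge1$). Let $P$ be its transition matrix, let $x$ be a stationary distribution ($x\ge0$, $xP=x$, $x\mathbf e=1$), and let the system start from $x$. Let $T$ be the delay, in slots, of the task that enters queue 1 in a given slot $k$: the time from $t_{k+1}$ until its computation completes. All probabilities of events about $T$ are conditional on the event that a task does enter queue 1 in slot $k$. Put $\bar W_n=\mathsf P\{T\le n\}$, $PW_n=\mathsf P\{T=n\}$, $W_n=\mathsf P\{T>n\}$. Let $\hat P$ be the part of $P$ that belongs to transitions in which a task enters queue 1, and let $\tilde x^{(0)}=z=x\hat P/(x\hat P\mathbf e)$. Let $\tilde P$ be the transition matrix of the same system without new arrivals, i.e. $P$ with $D_0$ replaced by $I$ and $D_1$ by $0$, and let $\tilde x^{(n)}=z\tilde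 P^{\,n}$. Let $\tilde x^{(n)}_{00}$ be the part of $\tilde x^{(n)}$ on the states with $i_1=i_2=0$. **Proposition.** For every slot $k$, a task enters queue 1 in slot $k$ with positive probability, $\bar W_0=0$, and for all $n\ge1$ $$\bar W_n=\tilde x^{(n)}_{00}\,\mathbf e,\qquad PW_n=\bar W_n-\bar W_{n-1},\qquad W_n=1-\bar W_n .$$ -/

import Mathlib

namespace TandemQueue

open scoped Matrix

/-- A representation `(α, T)` of order `n` of a discrete phase-type distribution: the law of the
absorption time of the Markov chain on `n` transient phases and one absorbing state which starts
from `α` and moves among the transient phases according to `T`. -/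
structure DPH (n : ℕ) where
  init : Fin n → ℝ
  trans : Matrix (Fin n) (Fin n) ℝ

/-- The vector `T⁰ = e - T e` of absorption probabilities. -/
def DPH.exit {n : ℕ} (F : DPH n) (j : Fin n) : ℝ := 1 - ∑ j', F.trans j j'

/-- `(α, T)` represents a distribution on `{1, 2, …}`: `α` is a probability vector on the transient
phases, `T` is substochastic and `I - T` is nonsingular. -/
structure DPH.IsValid {n : ℕ} (F : DPH n) : Prop where
  init_nonneg : ∀ j, 0 ≤ F.init j
  init_sum : ∑ j, F.init j = 1
  trans_nonneg : ∀ i j, 0 ≤ F.trans i j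
  trans_sum : ∀ i, ∑ j, F.trans i j ≤ 1
  nonsing : IsUnit (1 - F.trans)

/-- `D₀, D₁` are the parameters of a discrete-time Markovian arrival process with positive average
arrival rate `π D₁ e`, where `π` is stationary for `D₀ + D₁`. -/
structure IsDMAP {m : ℕ} (D₀ D₁ : Matrix (Fin m) (Fin m) ℝ) : Prop where
  nonneg₀ : ∀ i j, 0 ≤ D₀ i j
  nonneg₁ : ∀ i j, 0 ≤ D₁ i j
  exists_pos₀ : ∃ i j, 0 < D₀ i j
  exists_pos₁ : ∃ i j, 0 < D₁ i j
  row_sum : ∀ i, ∑ j, (D₀ + D₁) i j = 1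
  rate_pos : ∀ π : Fin m → ℝ, (∀ i, 0 ≤ π i) → ∑ i, π i = 1 → π ᵥ* (D₀ + D₁) = π →
    0 < ∑ i, (π ᵥ* D₁) i

/-- The stochastic ingredients of the tandem queue. -/
structure Params (m n₁ n₂ l : ℕ) where
  /-- arrival process: phase transitions without an arrival -/
  D₀ : Matrix (Fin m) (Fin m) ℝ
  /-- arrival process: phase transitions with an arrival -/
  D₁ : Matrix (Fin m) (Fin m) ℝ
  /-- transmission times, `(β₁, S₁)` -/
  tx : DPH n₁
  /-- computation times, `(β₂, S₂)` -/
  comp : DPH n₂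
  /-- vacation durations, `(v, V)` -/
  vac : DPH l

structure Params.IsValid {m n₁ n₂ l : ℕ} (Q : Params m n₁ n₂ l) : Prop where
  dmap : IsDMAP Q.D₀ Q.D₁
  tx : Q.tx.IsValid
  comp : Q.comp.IsValid
  vac : Q.vac.IsValid

/-- The state space `Ψ`: queue lengths (including the tasks in service), the phase of the arrival
process, the phase of server 1 and the phase of server 2. Server 1 is idle (`none`) exactly when
queue 1 is empty; otherwise it is on vacation in some vacation phase (`some (inl j)`) or it
transmits in some transmission phase (`some (inr j)`), the latter only if queue 2 is not full.
Server 2 is idle (`none`) exactly when queue 2 is empty. -/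
structure State (m n₁ n₂ l N₁ N₂ : ℕ) where
  i₁ : Fin (N₁ + 1)
  i₂ : Fin (N₂ + 1)
  ph : Fin m
  p₁ : Option (Fin l ⊕ Fin n₁)
  p₂ : Option (Fin n₂)
  idle₁ : p₁ = none ↔ i₁ = 0
  idle₂ : p₂ = none ↔ i₂ = 0
  full : i₂ = Fin.last N₂ → ∀ j, p₁ ≠ some (Sum.inr j)

noncomputable instance {m n₁ n₂ l N₁ N₂ : ℕ} : Fintype (State m n₁ n₂ l N₁ N₂) :=
  Fintype.ofInjective (fun s => (s.i₁, s.i₂, s.ph, s.p₁, s.p₂)) (by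
    rintro ⟨⟩ ⟨⟩ h
    simpa using h)

/-- What happens during one time slot: whether a task is generated, whether server 1 completes a
transmission, and whether server 2 completes a computation. -/
structure Slot where
  arrival : Bool
  sent : Bool
  done : Bool
deriving DecidableEq, Fintype

section Dynamics

variable {m n₁ n₂ l N₁ N₂ : ℕ}

/-- A generated task enters queue 1 iff there is room for it, possibly room made by a transmission
that completes in the same slot; otherwise it is rejected. -/
def enters (s : State m n₁ n₂ l N₁ N₂) (e : Slot) : Bool :=
  e.arrival && (decide ((s.i₁ : ℕ) < N₁) || e.sent)

/-- Probability of the phase `p'` with which server 2 starts, when it is not busy with a task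
already: idle if there is no task, and a fresh computation phase otherwise. -/
def Params.start₂ (Q : Params m n₁ n₂ l) : Option (Fin n₂) → ℝ
  | none => 1
  | some j => Q.comp.init j

/-- Server 2: probability of the outcome of a slot (`done`: the computation in progress completes)
together with the new phase, given the old phase. -/
def Params.server₂ (Q : Params m n₁ n₂ l) : Option (Fin n₂) → Bool → Option (Fin n₂) → ℝ
  | none, false, p' => Q.start₂ p'
  | none, true, _ => 0
  | some j, false, some j' => Q.comp.trans j j'
  | some _, false, none => 0
  | some j, true, p' => Q.comp.exit j * Q.start₂ p'

/-- Probability of the phase with which server 1 starts, when it has to decide what to do next: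
idle if queue 1 is empty; otherwise a new vacation if queue 2 is full and a new transmission if
queue 2 is not full. -/
def Params.start₁ (Q : Params m n₁ n₂ l) (full : Bool) : Option (Fin l ⊕ Fin n₁) → ℝ
  | none => 1
  | some (Sum.inl j) => if full then Q.vac.init j else 0
  | some (Sum.inr j) => if full then 0 else Q.tx.init j

/-- Server 1: probability of the outcome of a slot (`sent`: the transmission in progress completes)
together with the new phase, given the old phase; `full` says whether queue 2 is full at the end of
the slot. -/
def Params.server₁ (Q : Params m n₁ n₂ l) (full : Bool) :
    Option (Fin l ⊕ Fin n₁) → Bool → Option (Fin l ⊕ Fin n₁) → ℝ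
  | none, false, p' => Q.start₁ full p'
  | none, true, _ => 0
  | some (Sum.inr j), false, some (Sum.inr j') => Q.tx.trans j j'
  | some (Sum.inr _), false, _ => 0
  | some (Sum.inr j), true, p' => Q.tx.exit j * Q.start₁ full p'
  | some (Sum.inl j), false, some (Sum.inl j') =>
      Q.vac.trans j j' + Q.vac.exit j * Q.start₁ full (some (Sum.inl j'))
  | some (Sum.inl j), false, some (Sum.inr j') =>
      Q.vac.exit j * Q.start₁ full (some (Sum.inr j'))
  | some (Sum.inl _), false, none => 0
  | some (Sum.inl _), true, _ => 0

/-- The probability that, from state `s`, the events of the next slot are `e` and the state at the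
end of the slot is `s'`. -/
noncomputable def Params.step (Q : Params m n₁ n₂ l) (s : State m n₁ n₂ l N₁ N₂) (e : Slot)
    (s' : State m n₁ n₂ l N₁ N₂) : ℝ :=
  if (s'.i₁ : ℕ) + e.sent.toNat = s.i₁ + (enters s e).toNat ∧
      (s'.i₂ : ℕ) + e.done.toNat = s.i₂ + e.sent.toNat then
    (if e.arrival then Q.D₁ else Q.D₀) s.ph s'.ph *
      Q.server₁ (decide (s'.i₂ = Fin.last N₂)) s.p₁ e.sent s'.p₁ *
      Q.server₂ s.p₂ e.done s'.p₂
  else 0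

/-- The one-step transition probability matrix `P` of the chain `Ξ` on `Ψ`. -/
noncomputable def Params.P (Q : Params m n₁ n₂ l) (N₁ N₂ : ℕ) :
    Matrix (State m n₁ n₂ l N₁ N₂) (State m n₁ n₂ l N₁ N₂) ℝ :=
  fun s s' => ∑ e : Slot, Q.step s e s'

/-- The part `P̂` of `P` that belongs to transitions in which a task enters queue 1. -/
noncomputable def Params.Phat (Q : Params m n₁ n₂ l) (N₁ N₂ : ℕ) :
    Matrix (State m n₁ n₂ l N₁ N₂) (State m n₁ n₂ l N₁ N₂) ℝ :=
  fun s s' => ∑ e : Slot, if enters s e then Q.step s e s' else 0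

/-- The same system without new arrivals: `D₀` is replaced by `I` and `D₁` by `0`. -/
def Params.noArrivals (Q : Params m n₁ n₂ l) : Params m n₁ n₂ l :=
  { Q with D₀ := 1, D₁ := 0 }

/-- `x` is a stationary distribution of the chain `Ξ`. -/
structure Params.IsStationary (Q : Params m n₁ n₂ l) (x : State m n₁ n₂ l N₁ N₂ → ℝ) : Prop where
  nonneg : ∀ s, 0 ≤ x s
  sum_eq_one : ∑ s, x s = 1
  stationary : x ᵥ* Q.P N₁ N₂ = x

/-- The stationary distribution `z` just after a task enters queue 1: `x P̂`, normalized. -/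
noncomputable def Params.z (Q : Params m n₁ n₂ l) (x : State m n₁ n₂ l N₁ N₂ → ℝ) :
    State m n₁ n₂ l N₁ N₂ → ℝ :=
  (∑ s, (x ᵥ* Q.Phat N₁ N₂) s)⁻¹ • (x ᵥ* Q.Phat N₁ N₂)

/-- The distribution `x̃⁽ⁿ⁾` after `n` slots of the chain without new arrivals, started from `z`. -/
noncomputable def Params.xTilde (Q : Params m n₁ n₂ l) (x : State m n₁ n₂ l N₁ N₂ → ℝ) :
    ℕ → State m n₁ n₂ l N₁ N₂ → ℝ
  | 0 => Q.z x
  | n + 1 => Q.xTilde x n ᵥ* Q.noArrivals.P N₁ N₂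

open Classical in
/-- The mass `y₀₀ e` that a vector `y` on `Ψ` puts on level `(0, 0)`. -/
noncomputable def emptyMass (y : State m n₁ n₂ l N₁ N₂ → ℝ) : ℝ :=
  ∑ s, if s.i₁ = 0 ∧ s.i₂ = 0 then y s else 0

/-- The contents of queue 1 and of queue 2 (heads of the queues first) at the times `t_k`, along a
trajectory of states `s` and slot events `e`; slot `k` lasts from `t_k` to `t_{k+1}`. Each task is
labelled by the index of the time at which it enters queue 1, the tasks that are in the system at
`t_0` by `0`. Both queues are FIFO. -/
def contents (s : ℕ → State m n₁ n₂ l N₁ N₂) (e : ℕ → Slot) : ℕ → List ℕ × List ℕ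
  | 0 => (List.replicate (s 0).i₁ 0, List.replicate (s 0).i₂ 0)
  | k + 1 =>
    let q := contents s e k
    ((if (e k).sent then q.1.tail else q.1) ++ (if enters (s k) (e k) then [k + 1] else []),
      (if (e k).done then q.2.tail else q.2) ++ (if (e k).sent then q.1.take 1 else []))

/-- The computation of the task with label `a` completes in slot `k`. -/
def completes (s : ℕ → State m n₁ n₂ l N₁ N₂) (e : ℕ → Slot) (k a : ℕ) : Prop :=
  (e k).done = true ∧ (contents s e k).2.head? = some a

/-- The delay, in slots, of the task that enters queue 1 in slot `k`, that is, at `t_{k+1}`: it is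
`n` if the computation of this task completes in slot `k + n`, that is, at `t_{k+1+n}`, and `⊤` if
the computation never completes. -/
noncomputable def delay (s : ℕ → State m n₁ n₂ l N₁ N₂) (e : ℕ → Slot) (k : ℕ) : ℕ∞ :=
  ⨅ (n : ℕ) (_ : completes s e (k + n) (k + 1)), (n : ℕ∞)

open MeasureTheory in
/-- The random states `X k` at `t_k` and slot events `E k` are a realization, on the probability
space `(Ω, μ)`, of the tandem queue with initial distribution `x`. -/
structure Params.IsRealization (Q : Params m n₁ n₂ l) (x : State m n₁ n₂ l N₁ N₂ → ℝ)
    {Ω : Type*} [MeasurableSpace Ω] (μ : Measure Ω)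
    (X : ℕ → Ω → State m n₁ n₂ l N₁ N₂) (E : ℕ → Ω → Slot) : Prop where
  measurable_state : ∀ k a, MeasurableSet {ω | X k ω = a}
  measurable_slot : ∀ k a, MeasurableSet {ω | E k ω = a}
  law : ∀ (k : ℕ) (s : ℕ → State m n₁ n₂ l N₁ N₂) (e : ℕ → Slot),
    μ.real {ω | (∀ i ≤ k, X i ω = s i) ∧ ∀ i < k, E i ω = e i} =
      x (s 0) * ∏ i ∈ Finset.range k, Q.step (s i) (e i) (s (i + 1))

end Dynamics

/-- The event that a task enters queue 1 in slot `k`. -/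
def enterEvent {m n₁ n₂ l N₁ N₂ : ℕ} {Ω : Type*} (X : ℕ → Ω → State m n₁ n₂ l N₁ N₂)
    (E : ℕ → Ω → Slot) (k : ℕ) : Set Ω :=
  {ω | enters (X k ω) (E k ω) = true}

/-- The delay of the task that enters queue 1 in slot `k`, as a random variable. -/
noncomputable def randomDelay {m n₁ n₂ l N₁ N₂ : ℕ} {Ω : Type*}
    (X : ℕ → Ω → State m n₁ n₂ l N₁ N₂) (E : ℕ → Ω → Slot) (k : ℕ) (ω : Ω) : ℕ∞ :=
  delay (fun i => X i ω) (fun i => E i ω) k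

/-- `P{T ∈ A}`: the probability that the delay of the task that enters queue 1 in slot `k` lies in
`A`, given that a task enters queue 1 in slot `k`. -/
noncomputable def delayProb {m n₁ n₂ l N₁ N₂ : ℕ} {Ω : Type*} [MeasurableSpace Ω]
    (μ : MeasureTheory.Measure Ω) (X : ℕ → Ω → State m n₁ n₂ l N₁ N₂) (E : ℕ → Ω → Slot)
    (k : ℕ) (A : Set ℕ∞) : ℝ :=
  (ProbabilityTheory.cond μ (enterEvent X E k)).real {ω | randomDelay X E k ω ∈ A}

end TandemQueue

namespace TandemQueue

open scoped Matrix

/-! As regards the order of departure, the two FIFO queues in series form one FIFO list: a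
transmission moves a task across the boundary without changing the order. Hence a task that enters
in slot k leaves exactly when the number of computations completed since t_{k+1} reaches i₁ + i₂,
the number of tasks present just after its entry (`delay_le_iff_doneCount`). With the Markov
property, the probability that a task enters and has T ≤ n is x P̂ integrated against `doneAtLeast n
s (i₁ + i₂)` (`law_delay`).

The crux is that later arrivals do not influence this probability. They stand behind the tagged
task, and can affect server 1 only once that task is already in queue 2, where server 1 no longer
matters to it. `doneAtLeast_eq_tagged` makes this exact: the probability obeys a recursion from
which the arrival matrices have dropped out, so it is the same for the system without arrivals.
There, as many completions as tasks present means an empty system, and the backward recursion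
transposes into the forward iteration x̃ (`emptyMass_xTilde`).

Conditioning requires a positive entry rate (`sum_Phat_pos`). If the rate were zero, stationarity
would exclude transmissions and computations from completing, since queue lengths could only
decrease. The mean remaining work of a busy server would then drop by one per slot, so both servers
would be idle. Every generated task would be admitted, so none could be generated, which contradicts
π D₁ e > 0 for the marginal law π of the arrival phase. -/

variable {m n₁ n₂ l N₁ N₂ : ℕ}

/-! ### One slot: server kernels and factorization of the transition law -/

/-- The transition kernel of server 1, restricted to the new phases that agree with `idle`. -/
def Params.kernel₁ (Q : Params m n₁ n₂ l) (idle full : Bool) (p : Option (Fin l ⊕ Fin n₁))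
    (sent : Bool) (p' : Option (Fin l ⊕ Fin n₁)) : ℝ :=
  if p'.isNone = idle then Q.server₁ full p sent p' else 0

/-- The transition kernel of server 2, restricted to the new phases that agree with `idle`. -/
def Params.kernel₂ (Q : Params m n₁ n₂ l) (idle : Bool) (p : Option (Fin n₂))
    (done : Bool) (p' : Option (Fin n₂)) : ℝ :=
  if p'.isNone = idle then Q.server₂ p done p' else 0

/-- The probability of the outcome `sent` of a slot at server 1. -/
def Params.sendProb (Q : Params m n₁ n₂ l) : Option (Fin l ⊕ Fin n₁) → Bool → ℝ
  | some (Sum.inr j), true => Q.tx.exit j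
  | some (Sum.inr j), false => 1 - Q.tx.exit j
  | _, true => 0
  | _, false => 1

/-- The probability of the outcome `done` of a slot at server 2. -/
def Params.doneProb (Q : Params m n₁ n₂ l) : Option (Fin n₂) → Bool → ℝ
  | some j, true => Q.comp.exit j
  | some j, false => 1 - Q.comp.exit j
  | none, true => 0
  | none, false => 1

/-- The arrival matrix that belongs to the outcome `a` of a slot. -/
def Params.arr (Q : Params m n₁ n₂ l) (a : Bool) (i j : Fin m) : ℝ :=
  (if a then Q.D₁ else Q.D₀) i j

/-- The length of queue 1 after a slot. -/
def next₁ (s : State m n₁ n₂ l N₁ N₂) (e : Slot) : ℕ :=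
  s.i₁ + (enters s e).toNat - e.sent.toNat

/-- The length of queue 2 after a slot. -/
def next₂ (i : ℕ) (sent done : Bool) : ℕ := i + sent.toNat - done.toNat

theorem sum_sendProb (Q : Params m n₁ n₂ l) (p : Option (Fin l ⊕ Fin n₁)) :
    ∑ b, Q.sendProb p b = 1 := by
  rcases p with _ | _ | _ <;> simp [Params.sendProb]

theorem sum_doneProb (Q : Params m n₁ n₂ l) (p : Option (Fin n₂)) :
    ∑ b, Q.doneProb p b = 1 := by
  rcases p with _ | _ <;> simp [Params.doneProb]

theorem sum_start₁ {Q : Params m n₁ n₂ l} (ht : ∑ j, Q.tx.init j = 1)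
    (hv : ∑ j, Q.vac.init j = 1) (idle full : Bool) :
    ∑ p, (if p.isNone = idle then Q.start₁ full p else 0) = 1 := by
  cases idle <;> cases full <;> simp [Fintype.sum_option, Params.start₁, ht, hv]

theorem sum_start₂ {Q : Params m n₁ n₂ l} (hc : ∑ j, Q.comp.init j = 1) (idle : Bool) :
    ∑ p, (if p.isNone = idle then Q.start₂ p else 0) = 1 := by
  cases idle <;> simp [Fintype.sum_option, Params.start₂, hc]

/-- A fresh start has total mass 1 under either value of `idle`: weight 1 on `none`, or the initial
vector. Only an unfinished computation forces `idle = false`. So the outcome of a slot has a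
probability that does not depend on the resulting queue length. -/
theorem sum_kernel₂ {Q : Params m n₁ n₂ l} (hc : ∑ j, Q.comp.init j = 1) (idle : Bool)
    (p : Option (Fin n₂)) (done : Bool) (h : p ≠ none → done = false → idle = false) :
    ∑ p', Q.kernel₂ idle p done p' = Q.doneProb p done := by
  have h2 := sum_start₂ hc idle
  rcases p with _ | j <;> cases done
  · simpa [Params.kernel₂, Params.server₂, Params.doneProb] using h2
  · simp [Params.kernel₂, Params.server₂, Params.doneProb]
  · obtain rfl := h (by simp) rfl
    simp [Fintype.sum_option, Params.kernel₂, Params.server₂, Params.doneProb, DPH.exit]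
  · simp only [Params.kernel₂, Params.server₂, Params.doneProb]
    conv_rhs => rw [← mul_one (Q.comp.exit j), ← h2, Finset.mul_sum]
    simp only [mul_ite, mul_zero]

theorem sum_kernel₁ {Q : Params m n₁ n₂ l} (ht : ∑ j, Q.tx.init j = 1)
    (hv : ∑ j, Q.vac.init j = 1) (idle full : Bool)
    (p : Option (Fin l ⊕ Fin n₁)) (sent : Bool) (h : p ≠ none → sent = false → idle = false) :
    ∑ p', Q.kernel₁ idle full p sent p' = Q.sendProb p sent := by
  have h2 := sum_start₁ ht hv idle full
  rcases p with _ | j | j <;> cases sent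
  · simpa [Params.kernel₁, Params.server₁, Params.sendProb] using h2
  · simp [Params.kernel₁, Params.server₁, Params.sendProb]
  · obtain rfl := h (by simp) rfl
    cases full <;>
    simp [Fintype.sum_option, Params.kernel₁, Params.server₁, Params.sendProb, Params.start₁,
      Finset.sum_add_distrib, ← Finset.mul_sum, ht, hv] <;> simp [DPH.exit]
  · simp [Params.kernel₁, Params.server₁, Params.sendProb]
  · obtain rfl := h (by simp) rfl
    simp [Fintype.sum_option, Params.kernel₁, Params.server₁, Params.sendProb, DPH.exit]
  · simp only [Params.kernel₁, Params.server₁, Params.sendProb]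
    conv_rhs => rw [← mul_one (Q.tx.exit j), ← h2, Finset.mul_sum]
    simp only [mul_ite, mul_zero]

theorem i₁_pos {s : State m n₁ n₂ l N₁ N₂} : s.p₁ ≠ none ↔ 0 < (s.i₁ : ℕ) := by
  rw [Ne, s.idle₁, Fin.ext_iff, Fin.val_zero, Nat.pos_iff_ne_zero]

theorem i₂_pos {s : State m n₁ n₂ l N₁ N₂} : s.p₂ ≠ none ↔ 0 < (s.i₂ : ℕ) := by
  rw [Ne, s.idle₂, Fin.ext_iff, Fin.val_zero, Nat.pos_iff_ne_zero]

theorem exists_of_server₁_ne_zero {Q : Params m n₁ n₂ l} {full : Bool}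
    {p p' : Option (Fin l ⊕ Fin n₁)} (h : Q.server₁ full p true p' ≠ 0) :
    ∃ j, p = some (Sum.inr j) := by
  rcases p with _ | j | j <;> simp_all [Params.server₁]

theorem ne_none_of_server₂_ne_zero {Q : Params m n₁ n₂ l}
    {p p' : Option (Fin n₂)} (h : Q.server₂ p true p' ≠ 0) : p ≠ none := by
  rintro rfl
  simp [Params.server₂] at h

/-- A transmission runs only when queue 1 is nonempty and queue 2 is not full, so a transmitted task
always finds room. -/
theorem sent_le {Q : Params m n₁ n₂ l} {s : State m n₁ n₂ l N₁ N₂} {full sent : Bool}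
    {p' : Option (Fin l ⊕ Fin n₁)} (h : Q.server₁ full s.p₁ sent p' ≠ 0) :
    sent.toNat ≤ (s.i₁ : ℕ) ∧ (s.i₂ : ℕ) + sent.toNat ≤ N₂ := by
  cases sent
  · exact ⟨Nat.zero_le _, Nat.le_of_lt_succ s.i₂.2⟩
  · obtain ⟨j, hj⟩ := exists_of_server₁_ne_zero h
    have h1 : 0 < (s.i₁ : ℕ) := i₁_pos.1 (by simp [hj])
    have h2 : (s.i₂ : ℕ) ≠ N₂ := fun h => s.full (Fin.ext h) j hj
    have := s.i₂.2
    simp only [Bool.toNat_true]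
    omega

theorem done_le {Q : Params m n₁ n₂ l} {s : State m n₁ n₂ l N₁ N₂} {done : Bool}
    {p' : Option (Fin n₂)} (h : Q.server₂ s.p₂ done p' ≠ 0) : done.toNat ≤ (s.i₂ : ℕ) := by
  cases done
  · exact Nat.zero_le _
  · exact i₂_pos.1 (ne_none_of_server₂_ne_zero h)

theorem next₁_lt {Q : Params m n₁ n₂ l} {s : State m n₁ n₂ l N₁ N₂} {full : Bool} {e : Slot}
    {p' : Option (Fin l ⊕ Fin n₁)} (h : Q.server₁ full s.p₁ e.sent p' ≠ 0) :
    next₁ s e < N₁ + 1 := by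
  have := (sent_le h).1
  have h1 := s.i₁.2
  unfold next₁
  cases ha : enters s e
  · simp
    omega
  · unfold enters at ha
    cases hs : e.sent <;> simp_all

/-- The invariant `State.full` survives a slot. If queue 2 ends full, no transmission starts; one
that merely continues would mean that queue 2 was full already at the start, as nothing was added to
it. -/
theorem ne_inr_of_full {Q : Params m n₁ n₂ l} {s : State m n₁ n₂ l N₁ N₂} {sent done : Bool}
    {p' : Option (Fin l ⊕ Fin n₁)} (hi : next₂ s.i₂ sent done = N₂)
    (h : Q.server₁ true s.p₁ sent p' ≠ 0) (j : Fin n₁) : p' ≠ some (Sum.inr j) := by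
  rintro rfl
  have h1 := s.i₂.2
  cases sent
  · cases hp : s.p₁ with
    | none => simp [hp, Params.server₁, Params.start₁] at h
    | some q =>
      rcases q with q | q
      · simp [hp, Params.server₁, Params.start₁] at h
      · refine s.full (Fin.ext ?_) q hp
        simp [next₂] at hi ⊢
        omega
  · obtain ⟨q, hq⟩ := exists_of_server₁_ne_zero h
    simp [hq, Params.server₁, Params.start₁] at h

theorem step_ne_zero {Q : Params m n₁ n₂ l} {s s' : State m n₁ n₂ l N₁ N₂} {e : Slot}
    (h : Q.step s e s' ≠ 0) :
    e.sent.toNat ≤ (s.i₁ : ℕ) ∧ e.done.toNat ≤ (s.i₂ : ℕ) ∧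
      (s'.i₁ : ℕ) + e.sent.toNat = s.i₁ + (enters s e).toNat ∧
      (s'.i₂ : ℕ) + e.done.toNat = s.i₂ + e.sent.toNat := by
  unfold Params.step at h
  obtain ⟨hc, h⟩ := ite_ne_right_iff.1 h
  simp only [ne_eq, mul_eq_zero, not_or] at h
  exact ⟨(sent_le h.1.2).1, done_le h.2, hc⟩

theorem isNone_eq_decide_iff {α : Type*} {p : Option α} {i : ℕ} :
    p.isNone = decide (i = 0) ↔ (p = none ↔ i = 0) := by
  rw [Bool.eq_iff_iff]
  simp

/-- Given the old state and the events, the new queue lengths are determined, so the new state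
amounts to its three phases. Triples that violate a state invariant have weight zero, so the sum may
run over all triples and then factorizes. -/
theorem sum_step (Q : Params m n₁ n₂ l) (s : State m n₁ n₂ l N₁ N₂) (e : Slot)
    (G : Fin m → Option (Fin l ⊕ Fin n₁) → Option (Fin n₂) → ℝ) :
    ∑ s', Q.step s e s' * G s'.ph s'.p₁ s'.p₂ =
      ∑ h, ∑ p₁, ∑ p₂, Q.arr e.arrival s.ph h *
        Q.kernel₁ (decide (next₁ s e = 0)) (decide (next₂ s.i₂ e.sent e.done = N₂))
          s.p₁ e.sent p₁ *
        Q.kernel₂ (decide (next₂ s.i₂ e.sent e.done = 0)) s.p₂ e.done p₂ * G h p₁ p₂ := by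
  have key : ∀ s' : State m n₁ n₂ l N₁ N₂, (s'.i₁ : ℕ) + e.sent.toNat =
      s.i₁ + (enters s e).toNat ∧ (s'.i₂ : ℕ) + e.done.toNat = s.i₂ + e.sent.toNat →
      Q.step s e s' = Q.arr e.arrival s.ph s'.ph *
        Q.kernel₁ (decide (next₁ s e = 0)) (decide (next₂ s.i₂ e.sent e.done = N₂))
          s.p₁ e.sent s'.p₁ *
        Q.kernel₂ (decide (next₂ s.i₂ e.sent e.done = 0)) s.p₂ e.done s'.p₂ := by
    intro s' hs
    have e1 : next₁ s e = s'.i₁ := by unfold next₁; omega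
    have e2 : next₂ s.i₂ e.sent e.done = s'.i₂ := by unfold next₂; omega
    have d1 : s'.p₁.isNone = decide ((s'.i₁ : ℕ) = 0) := by
      rw [isNone_eq_decide_iff, s'.idle₁, Fin.ext_iff, Fin.val_zero]
    have d2 : s'.p₂.isNone = decide ((s'.i₂ : ℕ) = 0) := by
      rw [isNone_eq_decide_iff, s'.idle₂, Fin.ext_iff, Fin.val_zero]
    have d3 : (s'.i₂ = Fin.last N₂) = ((s'.i₂ : ℕ) = N₂) := by
      rw [Fin.ext_iff, Fin.val_last]
    rw [Params.step, if_pos hs, e1, e2, Params.kernel₁, Params.kernel₂, if_pos d1, if_pos d2]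
    simp only [d3, Params.arr]
  simp only [← Fintype.sum_prod_type']
  have hc : ∀ s', Q.step s e s' * G s'.ph s'.p₁ s'.p₂ ≠ 0 → Q.step s e s' ≠ 0 :=
    fun s' h => left_ne_zero_of_mul h
  refine Finset.sum_bij_ne_zero (fun s' _ _ => (s'.ph, s'.p₁, s'.p₂)) ?_ ?_ ?_ ?_
  · simp
  · intro a _ ha b _ hb hab
    have h1 := step_ne_zero (hc a ha)
    have h2 := step_ne_zero (hc b hb)
    rcases a with ⟨a1, a2⟩
    rcases b with ⟨b1, b2⟩
    simp only [Prod.mk.injEq] at hab h1 h2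
    simp only [State.mk.injEq, Fin.ext_iff]
    refine ⟨by omega, by omega, congrArg _ hab.1, hab.2.1, hab.2.2⟩
  · rintro ⟨h, p₁, p₂⟩ _ hb
    simp only [Params.kernel₁, Params.kernel₂, ne_eq, mul_eq_zero, not_or, ite_eq_right_iff,
      Classical.not_imp, isNone_eq_decide_iff] at hb
    obtain ⟨⟨⟨h1, h2, h3⟩, h4, h5⟩, h6⟩ := hb
    have l1 := next₁_lt h3
    have l2 := sent_le h3
    have l3 := done_le h5
    -- The nonvanishing weight supplies every invariant needed to build a state from the triple.
    let s' : State m n₁ n₂ l N₁ N₂ :=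
      { i₁ := ⟨next₁ s e, l1⟩
        i₂ := ⟨next₂ s.i₂ e.sent e.done, by unfold next₂; omega⟩
        ph := h
        p₁ := p₁
        p₂ := p₂
        idle₁ := by rw [h2, Fin.ext_iff, Fin.val_zero]
        idle₂ := by rw [h4, Fin.ext_iff, Fin.val_zero]
        full := fun hf => by
          rw [Fin.ext_iff, Fin.val_last] at hf
          simp only at hf
          rw [decide_eq_true hf] at h3
          exact ne_inr_of_full hf h3 }
    have hs : (s'.i₁ : ℕ) + e.sent.toNat = s.i₁ + (enters s e).toNat ∧
        (s'.i₂ : ℕ) + e.done.toNat = s.i₂ + e.sent.toNat := by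
      simp only [s', next₁, next₂]
      omega
    refine ⟨s', Finset.mem_univ _, ?_, rfl⟩
    rw [key s' hs]
    simp only [Params.kernel₁, Params.kernel₂, ne_eq, mul_eq_zero, not_or, ite_eq_right_iff,
      Classical.not_imp, isNone_eq_decide_iff]
    exact ⟨⟨⟨h1, h2, h3⟩, h4, h5⟩, h6⟩
  · intro a _ ha
    rw [key a (step_ne_zero (hc a ha)).2.2]

theorem sum_slot (f : Slot → ℝ) : ∑ e, f e = ∑ a, ∑ b, ∑ c, f ⟨a, b, c⟩ := by
  simp only [← Fintype.sum_prod_type']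
  exact Fintype.sum_of_injective (fun e : Slot => (e.arrival, e.sent, e.done))
    (by rintro ⟨⟩ ⟨⟩; simp +contextual) f
    (fun q => f ⟨q.1, q.2.1, q.2.2⟩)
    (by rintro ⟨a, b, c⟩ h; exact absurd ⟨⟨a, b, c⟩, rfl⟩ h) (fun _ => rfl)

theorem next₁_idle {s : State m n₁ n₂ l N₁ N₂} {e : Slot} (h : s.p₁ ≠ none) (hs : e.sent = false) :
    decide (next₁ s e = 0) = false := by
  have := i₁_pos.1 h
  rw [decide_eq_false_iff_not, next₁, hs, Bool.toNat_false]
  omega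

theorem next₂_idle {s : State m n₁ n₂ l N₁ N₂} {b d : Bool} (h : s.p₂ ≠ none) (hs : d = false) :
    decide (next₂ s.i₂ b d = 0) = false := by
  have := i₂_pos.1 h
  rw [decide_eq_false_iff_not, next₂, hs, Bool.toNat_false]
  omega

/-- The initial vectors are normalized and the arrival process is stochastic. -/
structure Params.IsStoch (Q : Params m n₁ n₂ l) : Prop where
  tx : ∑ j, Q.tx.init j = 1
  comp : ∑ j, Q.comp.init j = 1
  vac : ∑ j, Q.vac.init j = 1
  arr : ∀ i, ∑ a, ∑ j, Q.arr a i j = 1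

theorem Params.IsValid.isStoch {Q : Params m n₁ n₂ l} (hQ : Q.IsValid) : Q.IsStoch where
  tx := hQ.tx.init_sum
  comp := hQ.comp.init_sum
  vac := hQ.vac.init_sum
  arr i := by
    rw [← hQ.dmap.row_sum i]
    simp [Params.arr, Finset.sum_add_distrib, add_comm]

theorem Params.IsStoch.noArrivals {Q : Params m n₁ n₂ l} (hQ : Q.IsStoch) :
    Q.noArrivals.IsStoch where
  tx := hQ.tx
  comp := hQ.comp
  vac := hQ.vac
  arr i := by simp [Params.arr, Params.noArrivals, Matrix.one_apply]

theorem sum_mul_triple {α β γ : Type*} [Fintype α] [Fintype β] [Fintype γ] {f : α → β → γ → ℝ}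
    (a : α → ℝ) (b : β → ℝ) (c : γ → ℝ) (hf : ∀ i j k, f i j k = a i * b j * c k) :
    ∑ i, ∑ j, ∑ k, f i j k = (∑ i, a i) * (∑ j, b j) * ∑ k, c k := by
  simp only [hf, ← Finset.mul_sum, ← Finset.sum_mul]

/-- The marginal law of the arrivals. -/
theorem sum_step_arrival {Q : Params m n₁ n₂ l} (hQ : Q.IsStoch) (s : State m n₁ n₂ l N₁ N₂)
    (g : Bool → Fin m → ℝ) :
    ∑ e, ∑ s', Q.step s e s' * g e.arrival s'.ph = ∑ a, ∑ h, Q.arr a s.ph h * g a h := by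
  have : ∀ e : Slot, ∑ s', Q.step s e s' * g e.arrival s'.ph =
      (∑ h, Q.arr e.arrival s.ph h * g e.arrival h) * Q.sendProb s.p₁ e.sent *
        Q.doneProb s.p₂ e.done := by
    intro e
    rw [sum_step Q s e (fun h _ _ => g e.arrival h), 
      sum_mul_triple (fun h => Q.arr e.arrival s.ph h * g e.arrival h)
        (fun p₁ => Q.kernel₁ (decide (next₁ s e = 0))
          (decide (next₂ s.i₂ e.sent e.done = N₂)) s.p₁ e.sent p₁)
        (fun p₂ => Q.kernel₂ (decide (next₂ s.i₂ e.sent e.done = 0)) s.p₂ e.done p₂)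
        (fun h p₁ p₂ => by ring),
      sum_kernel₁ hQ.tx hQ.vac _ _ _ _ (fun h hs => next₁_idle h hs),
      sum_kernel₂ hQ.comp _ _ _ (fun h hs => next₂_idle h hs)]
  simp only [this, sum_slot, ← Finset.mul_sum, sum_doneProb, sum_sendProb, mul_one]

theorem sum_step_eq_one {Q : Params m n₁ n₂ l} (hQ : Q.IsStoch) (s : State m n₁ n₂ l N₁ N₂) :
    ∑ e, ∑ s', Q.step s e s' = 1 := by
  have h := sum_step_arrival hQ s (fun _ _ => 1)
  simp only [mul_one] at h
  rw [h, hQ.arr]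

/-! ### The tagged task: later arrivals do not matter -/

/-- The probability that at least `r` computations complete during the next `n` slots. -/
noncomputable def Params.doneAtLeast (Q : Params m n₁ n₂ l) :
    ℕ → State m n₁ n₂ l N₁ N₂ → ℕ → ℝ
  | 0, _, r => if r = 0 then 1 else 0
  | n + 1, s, r => ∑ e, ∑ s', Q.step s e s' * Q.doneAtLeast n s' (r - e.done.toNat)

/-- The probability that a tagged task leaves within `n` slots, where the tagged task is the `r`-th
one in the system (counted from the head of queue 2), the length of queue 2 is `i`, and the servers
are in the phases `p₁` and `p₂`. -/
noncomputable def Params.tagged (Q : Params m n₁ n₂ l) (N₂ : ℕ) :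
    ℕ → ℕ → ℕ → Option (Fin l ⊕ Fin n₁) → Option (Fin n₂) → ℝ
  | 0, r, _, _, _ => if r = 0 then 1 else 0
  | n + 1, r, i, p₁, p₂ =>
    if r = 0 then 1
    -- The tagged task is in queue 2: server 1 is forgotten (`none`), and queue 2 is cut off behind
    -- the tagged task.
    else if r ≤ i then
      ∑ d : Bool, ∑ q₂, Q.kernel₂ false p₂ d q₂ *
        Q.tagged N₂ n (r - d.toNat) (r - d.toNat) none q₂
    else
      ∑ b : Bool, ∑ d : Bool, ∑ q₁, ∑ q₂,
        Q.kernel₁ false (decide (next₂ i b d = N₂)) p₁ b q₁ *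
          Q.kernel₂ (decide (next₂ i b d = 0)) p₂ d q₂ *
            Q.tagged N₂ n (r - d.toNat) (next₂ i b d) q₁ q₂

theorem tagged_zero (Q : Params m n₁ n₂ l) (n i : ℕ) (p₁ : Option (Fin l ⊕ Fin n₁))
    (p₂ : Option (Fin n₂)) : Q.tagged N₂ n 0 i p₁ p₂ = 1 := by
  cases n <;> simp [Params.tagged]

theorem tagged_of_le (Q : Params m n₁ n₂ l) (n : ℕ) {r i : ℕ} (h : r ≤ i)
    (p₁ : Option (Fin l ⊕ Fin n₁)) (p₂ : Option (Fin n₂)) :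
    Q.tagged N₂ n r i p₁ p₂ = Q.tagged N₂ n r r none p₂ := by
  cases n <;> simp [Params.tagged, h]

theorem tagged_noArrivals (Q : Params m n₁ n₂ l) (n r i : ℕ) (p₁ : Option (Fin l ⊕ Fin n₁))
    (p₂ : Option (Fin n₂)) :
    Q.noArrivals.tagged N₂ n r i p₁ p₂ = Q.tagged N₂ n r i p₁ p₂ := by
  have h1 : Q.noArrivals.kernel₁ = Q.kernel₁ := rfl
  have h2 : Q.noArrivals.kernel₂ = Q.kernel₂ := rfl
  induction n generalizing r i p₁ p₂ with
  | zero => rfl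
  | succ n ih => simp only [Params.tagged, h1, h2, ih]

/-- The bound on `r` is inherited by the next state, because a completion lowers `r` along with the
number of tasks. So the induction hypothesis applies after every possible slot, and `sum_step`
separates the phases. -/
theorem doneAtLeast_succ_eq {Q : Params m n₁ n₂ l} {n : ℕ}
    (ih : ∀ (s : State m n₁ n₂ l N₁ N₂) (r : ℕ), r ≤ s.i₁ + s.i₂ →
      Q.doneAtLeast n s r = Q.tagged N₂ n r s.i₂ s.p₁ s.p₂)
    (s : State m n₁ n₂ l N₁ N₂) {r : ℕ} (hr : r ≤ s.i₁ + s.i₂) :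
    Q.doneAtLeast (n + 1) s r = ∑ e : Slot, ∑ h, ∑ p₁, ∑ p₂, Q.arr e.arrival s.ph h *
        Q.kernel₁ (decide (next₁ s e = 0)) (decide (next₂ s.i₂ e.sent e.done = N₂))
          s.p₁ e.sent p₁ *
        Q.kernel₂ (decide (next₂ s.i₂ e.sent e.done = 0)) s.p₂ e.done p₂ *
        Q.tagged N₂ n (r - e.done.toNat) (next₂ s.i₂ e.sent e.done) p₁ p₂ := by
  rw [Params.doneAtLeast]
  refine Finset.sum_congr rfl fun e _ => ?_
  rw [← sum_step Q s e fun _ p₁ p₂ =>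
    Q.tagged N₂ n (r - e.done.toNat) (next₂ s.i₂ e.sent e.done) p₁ p₂]
  refine Finset.sum_congr rfl fun s' _ => ?_
  by_cases h : Q.step s e s' = 0
  · simp [h]
  · obtain ⟨h1, h2, h3, h4⟩ := step_ne_zero h
    rw [ih s' _ (by omega)]
    congr 2
    unfold next₂
    omega

/-- New tasks join behind the `r`-th one. They enter the factorized sum only through the arrival
matrices, whose rows sum to 1, and through the idle flag of server 1, which is immaterial whenever
it can be set. -/
theorem doneAtLeast_eq_tagged {Q : Params m n₁ n₂ l} (hQ : Q.IsStoch) (n : ℕ)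
    (s : State m n₁ n₂ l N₁ N₂) (r : ℕ) (hr : r ≤ s.i₁ + s.i₂) :
    Q.doneAtLeast n s r = Q.tagged N₂ n r s.i₂ s.p₁ s.p₂ := by
  induction n generalizing s r with
  | zero => rfl
  | succ n ih =>
    rw [doneAtLeast_succ_eq ih s hr, Params.tagged]
    split_ifs with h0 h1
    · subst h0
      simp only [zero_tsub, tagged_zero]
      refine Eq.trans ?_ (sum_step_eq_one hQ s)
      refine Finset.sum_congr rfl fun e _ => ?_
      simpa only [mul_one] using (sum_step Q s e fun _ _ _ => 1).symm
    · have key : ∀ e : Slot, ∑ h, ∑ p₁, ∑ p₂, Q.arr e.arrival s.ph h *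
          Q.kernel₁ (decide (next₁ s e = 0)) (decide (next₂ s.i₂ e.sent e.done = N₂))
            s.p₁ e.sent p₁ *
          Q.kernel₂ (decide (next₂ s.i₂ e.sent e.done = 0)) s.p₂ e.done p₂ *
          Q.tagged N₂ n (r - e.done.toNat) (next₂ s.i₂ e.sent e.done) p₁ p₂ =
          (∑ h, Q.arr e.arrival s.ph h) * Q.sendProb s.p₁ e.sent *
            ∑ q₂, Q.kernel₂ false s.p₂ e.done q₂ *
              Q.tagged N₂ n (r - e.done.toNat) (r - e.done.toNat) none q₂ := by
        intro e
        have hle : r - e.done.toNat ≤ next₂ s.i₂ e.sent e.done := by unfold next₂; omega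
        have hk : ∑ p₂, Q.kernel₂ (decide (next₂ s.i₂ e.sent e.done = 0)) s.p₂ e.done p₂ *
            Q.tagged N₂ n (r - e.done.toNat) (r - e.done.toNat) none p₂ =
            ∑ p₂, Q.kernel₂ false s.p₂ e.done p₂ *
            Q.tagged N₂ n (r - e.done.toNat) (r - e.done.toNat) none p₂ := by
          -- If the tagged task has just left, its value is 1 and the kernel mass ignores the idle
          -- flag; otherwise it is still in queue 2, so the flag is `false`.
          rcases Nat.eq_zero_or_pos (r - e.done.toNat) with hz | hz
          · simp only [hz, tagged_zero, mul_one]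
            rw [sum_kernel₂ hQ.comp _ _ _ (fun h hs => next₂_idle h hs),
              sum_kernel₂ hQ.comp _ _ _ (fun _ _ => rfl)]
          · rw [decide_eq_false (by omega)]
        rw [← hk, ← sum_kernel₁ hQ.tx hQ.vac (decide (next₁ s e = 0))
          (decide (next₂ s.i₂ e.sent e.done = N₂)) _ _ (fun h hs => next₁_idle h hs)]
        simp only [tagged_of_le Q n hle]
        exact sum_mul_triple _ _ _ fun _ _ _ => mul_assoc _ _ _
      rw [Finset.sum_congr rfl fun e _ => key e]
      simp only [sum_slot, ← Finset.mul_sum, ← Finset.sum_mul, sum_sendProb, hQ.arr, mul_one,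
        one_mul]
    · have key : ∀ e : Slot, ∑ h, ∑ p₁, ∑ p₂, Q.arr e.arrival s.ph h *
          Q.kernel₁ (decide (next₁ s e = 0)) (decide (next₂ s.i₂ e.sent e.done = N₂))
            s.p₁ e.sent p₁ *
          Q.kernel₂ (decide (next₂ s.i₂ e.sent e.done = 0)) s.p₂ e.done p₂ *
          Q.tagged N₂ n (r - e.done.toNat) (next₂ s.i₂ e.sent e.done) p₁ p₂ =
          (∑ h, Q.arr e.arrival s.ph h) * ∑ p₁, ∑ p₂,
          Q.kernel₁ false (decide (next₂ s.i₂ e.sent e.done = N₂)) s.p₁ e.sent p₁ *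
          Q.kernel₂ (decide (next₂ s.i₂ e.sent e.done = 0)) s.p₂ e.done p₂ *
          Q.tagged N₂ n (r - e.done.toNat) (next₂ s.i₂ e.sent e.done) p₁ p₂ := by
        intro e
        rw [Finset.sum_mul]
        refine Finset.sum_congr rfl fun h _ => ?_
        simp only [mul_assoc]
        simp only [← Finset.mul_sum]
        congr 1
        -- If queue 1 ends empty, the tagged task has left it, so the phase of server 1 is
        -- irrelevant and only the kernel mass remains.
        by_cases hi : next₁ s e = 0
        · have hle : r - e.done.toNat ≤ next₂ s.i₂ e.sent e.done := by
            unfold next₁ at hi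
            unfold next₂
            omega
          simp only [tagged_of_le Q n hle, ← Finset.sum_mul]
          rw [sum_kernel₁ hQ.tx hQ.vac _ _ _ _ (fun h hs => next₁_idle h hs),
              sum_kernel₁ hQ.tx hQ.vac _ _ _ _ (fun _ _ => rfl)]
        · rw [decide_eq_false hi]
      have key' : ∀ a b d : Bool, _ = (∑ h, Q.arr a s.ph h) * ∑ p₁, ∑ p₂,
          Q.kernel₁ false (decide (next₂ s.i₂ b d = N₂)) s.p₁ b p₁ *
          Q.kernel₂ (decide (next₂ s.i₂ b d = 0)) s.p₂ d p₂ *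
          Q.tagged N₂ n (r - d.toNat) (next₂ s.i₂ b d) p₁ p₂ := fun a b d => key ⟨a, b, d⟩
      rw [sum_slot]
      refine (Finset.sum_congr rfl fun a _ => Finset.sum_congr rfl fun b _ =>
        Finset.sum_congr rfl fun d _ => key' a b d).trans ?_
      simp only [← Finset.mul_sum]
      rw [← Finset.sum_mul, hQ.arr, one_mul]

/-- Later arrivals do not influence when the tasks that are present now leave. -/
theorem doneAtLeast_noArrivals {Q : Params m n₁ n₂ l} (hQ : Q.IsStoch) (n : ℕ)
    (s : State m n₁ n₂ l N₁ N₂) :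
    Q.doneAtLeast n s (s.i₁ + s.i₂) = Q.noArrivals.doneAtLeast n s (s.i₁ + s.i₂) := by
  rw [doneAtLeast_eq_tagged hQ n s _ le_rfl, doneAtLeast_eq_tagged hQ.noArrivals n s _ le_rfl,
    tagged_noArrivals]

theorem step_noArrivals_eq_zero (Q : Params m n₁ n₂ l) {s s' : State m n₁ n₂ l N₁ N₂} {e : Slot}
    (h : e.arrival = true) : Q.noArrivals.step s e s' = 0 := by
  simp [Params.step, h, Params.noArrivals]

/-- Without arrivals the number of tasks falls exactly by the completions, so the target `r` remains
the current total and need not be tracked separately. -/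
theorem doneAtLeast_noArrivals_succ (Q : Params m n₁ n₂ l) (n : ℕ) (s : State m n₁ n₂ l N₁ N₂) :
    Q.noArrivals.doneAtLeast (n + 1) s (s.i₁ + s.i₂) =
      ∑ s' : State m n₁ n₂ l N₁ N₂, Q.noArrivals.P N₁ N₂ s s' *
        Q.noArrivals.doneAtLeast n s' (s'.i₁ + s'.i₂) := by
  simp only [Params.doneAtLeast, Params.P, Finset.sum_mul]
  rw [Finset.sum_comm]
  refine Finset.sum_congr rfl fun s' _ => Finset.sum_congr rfl fun e _ => ?_
  by_cases h : Q.noArrivals.step s e s' = 0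
  · simp [h]
  · obtain ⟨h1, h2, h3, h4⟩ := step_ne_zero h
    have ha : enters s e = false := by
      by_contra hc
      refine h (step_noArrivals_eq_zero Q ?_)
      simp [enters] at hc
      exact hc.1
    rw [ha, Bool.toNat_false] at h3
    congr 2
    omega

/-- Slots are shifted one by one from the forward vector to the backward function; with no slots
left, the latter is the indicator of level (0, 0). -/
theorem emptyMass_xTilde (Q : Params m n₁ n₂ l) (x : State m n₁ n₂ l N₁ N₂ → ℝ) (n : ℕ) :
    emptyMass (Q.xTilde x n) =
      ∑ s : State m n₁ n₂ l N₁ N₂, Q.z x s * Q.noArrivals.doneAtLeast n s (s.i₁ + s.i₂) := by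
  have key : ∀ i n : ℕ, ∑ s : State m n₁ n₂ l N₁ N₂,
      Q.xTilde x (i + n) s * Q.noArrivals.doneAtLeast 0 s (s.i₁ + s.i₂) =
      ∑ s : State m n₁ n₂ l N₁ N₂,
        Q.xTilde x i s * Q.noArrivals.doneAtLeast n s (s.i₁ + s.i₂) := by
    intro i n
    induction n generalizing i with
    | zero => rfl
    | succ n ih =>
      rw [← Nat.add_assoc, Nat.add_right_comm, ih]
      simp only [doneAtLeast_noArrivals_succ, Params.xTilde, Matrix.vecMul, dotProduct,
        Finset.mul_sum, Finset.sum_mul]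
      rw [Finset.sum_comm]
      simp only [mul_assoc]
  have h := key 0 n
  rw [zero_add] at h
  simp only [Params.xTilde] at h
  rw [← h, emptyMass]
  refine Finset.sum_congr rfl fun s _ => ?_
  have : (s.i₁ = 0 ∧ s.i₂ = 0) ↔ (s.i₁ : ℕ) + s.i₂ = 0 := by
    rw [Fin.ext_iff, Fin.ext_iff, Fin.val_zero, Fin.val_zero, Nat.add_eq_zero_iff]
  simp only [Params.doneAtLeast, this, mul_ite, mul_one, mul_zero]

/-! ### Trajectories: the tandem as one FIFO list -/

/-- The labels of the tasks in the system, in the order in which they leave. -/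
def tasks (s : ℕ → State m n₁ n₂ l N₁ N₂) (e : ℕ → Slot) (k : ℕ) : List ℕ :=
  (contents s e k).2 ++ (contents s e k).1

/-- All transitions of a trajectory have positive probability. -/
def Params.IsPath (Q : Params m n₁ n₂ l) (s : ℕ → State m n₁ n₂ l N₁ N₂) (e : ℕ → Slot) : Prop :=
  ∀ i, Q.step (s i) (e i) (s (i + 1)) ≠ 0

/-- The number of computations that complete in the `n` slots from slot `k` on. -/
def doneCount (e : ℕ → Slot) (k n : ℕ) : ℕ := ∑ i ∈ Finset.range n, (e (k + i)).done.toNat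

theorem length_contents {Q : Params m n₁ n₂ l} {s : ℕ → State m n₁ n₂ l N₁ N₂} {e : ℕ → Slot}
    (h : Q.IsPath s e) (k : ℕ) :
    (contents s e k).1.length = (s k).i₁ ∧ (contents s e k).2.length = (s k).i₂ := by
  induction k with
  | zero => simp [contents]
  | succ k ih =>
    obtain ⟨h1, h2, h3, h4⟩ := step_ne_zero (h k)
    simp only [contents]
    cases hs : (e k).sent <;> cases hd : (e k).done <;> cases he : enters (s k) (e k) <;>
      simp [hs, hd, he, ih] at * <;> omega

/-- A transmission takes the head of queue 1 to the back of queue 2, which are adjacent places in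
the concatenation, so it leaves no trace there. -/
theorem tasks_succ {Q : Params m n₁ n₂ l} {s : ℕ → State m n₁ n₂ l N₁ N₂} {e : ℕ → Slot}
    (h : Q.IsPath s e) (k : ℕ) :
    tasks s e (k + 1) = (if (e k).done then (tasks s e k).tail else tasks s e k) ++
      (if enters (s k) (e k) then [k + 1] else []) := by
  obtain ⟨h1, h2, -, -⟩ := step_ne_zero (h k)
  obtain ⟨l1, l2⟩ := length_contents h k
  simp only [tasks, contents]
  rw [← List.append_assoc]
  congr 1
  rw [← l1] at h1
  rw [← l2] at h2
  generalize (contents s e k).1 = a at *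
  generalize (contents s e k).2 = b at *
  cases hs : (e k).sent <;> cases hd : (e k).done <;> rcases a with _ | ⟨a, a'⟩ <;>
    rcases b with _ | ⟨b, b'⟩ <;> simp_all <;> omega

/-- This makes the label `k + 1` new at the moment of its entry, hence unique. -/
theorem le_of_mem_contents {s : ℕ → State m n₁ n₂ l N₁ N₂} {e : ℕ → Slot} {k a : ℕ}
    (h : a ∈ (contents s e k).1 ∨ a ∈ (contents s e k).2) : a ≤ k := by
  induction k with
  | zero => simp [contents] at h; omega
  | succ k ih =>
    have hm : a = k + 1 ∨ a ∈ (contents s e k).1 ∨ a ∈ (contents s e k).2 := by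
      simp only [contents, List.mem_append] at h
      rcases h with (h | h) | (h | h)
      · split_ifs at h
        · exact Or.inr (Or.inl (List.mem_of_mem_tail h))
        · exact Or.inr (Or.inl h)
      · split_ifs at h
        · exact Or.inl (by simpa using h)
        · simp at h
      · split_ifs at h
        · exact Or.inr (Or.inr (List.mem_of_mem_tail h))
        · exact Or.inr (Or.inr h)
      · split_ifs at h
        · exact Or.inr (Or.inl (List.mem_of_mem_take h))
        · simp at h
    rcases hm with h | h
    · exact h.le
    · exact (ih h).trans (Nat.le_succ k)

theorem le_of_mem_tasks {s : ℕ → State m n₁ n₂ l N₁ N₂} {e : ℕ → Slot} {k a : ℕ}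
    (h : a ∈ tasks s e k) : a ≤ k :=
  le_of_mem_contents (List.mem_append.1 h).symm

theorem doneCount_succ (e : ℕ → Slot) (k n : ℕ) :
    doneCount e k (n + 1) = doneCount e k n + (e (k + n)).done.toNat :=
  Finset.sum_range_succ _ _

theorem doneCount_succ' (e : ℕ → Slot) (k n : ℕ) :
    doneCount e k (n + 1) = (e k).done.toNat + doneCount e (k + 1) n := by
  simp only [doneCount, Finset.sum_range_succ' _ n, add_zero, add_comm _ (e k).done.toNat]
  simp only [Nat.add_assoc, Nat.add_comm 1]

/-- The task that enters in slot `k` is preceded by the tasks that were there before it and have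
not left yet, or it has left. -/
theorem tasks_of_enters {Q : Params m n₁ n₂ l} {s : ℕ → State m n₁ n₂ l N₁ N₂} {e : ℕ → Slot}
    (h : Q.IsPath s e) {k : ℕ} (hk : enters (s k) (e k) = true) (j : ℕ) :
    (∃ A M, tasks s e (k + 1 + j) = A ++ (k + 1) :: M ∧ (∀ a ∈ A, a ≤ k) ∧ k + 1 ∉ M ∧
      A.length + 1 + doneCount e (k + 1) j = (s (k + 1)).i₁ + (s (k + 1)).i₂) ∨
    (k + 1 ∉ tasks s e (k + 1 + j) ∧
      ((s (k + 1)).i₁ : ℕ) + (s (k + 1)).i₂ ≤ doneCount e (k + 1) j) := by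
  induction j with
  | zero =>
    refine Or.inl ⟨if (e k).done then (tasks s e k).tail else tasks s e k, [], ?_, ?_,
      List.not_mem_nil, ?_⟩
    · rw [add_zero, tasks_succ h, if_pos hk]
    · intro a ha
      split_ifs at ha
      · exact le_of_mem_tasks (List.mem_of_mem_tail ha)
      · exact le_of_mem_tasks ha
    · obtain ⟨l1, l2⟩ := length_contents h (k + 1)
      have : (tasks s e (k + 1)).length = (s (k + 1)).i₁ + (s (k + 1)).i₂ := by
        rw [tasks, List.length_append, l1, l2, add_comm]
      rw [tasks_succ h, if_pos hk, List.length_append] at this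
      simpa [doneCount] using this
  | succ j ih =>
    have hnew : k + 1 ∉ (if enters (s (k + 1 + j)) (e (k + 1 + j)) then [k + 1 + j + 1] else []) := by
      split_ifs
      · rw [List.mem_singleton]
        omega
      · simp
    rw [← Nat.add_assoc, tasks_succ h, doneCount_succ]
    generalize (if enters (s (k + 1 + j)) (e (k + 1 + j)) then [k + 1 + j + 1] else []) = new at hnew
    rcases ih with ⟨A, M, h1, h2, hM, h3⟩ | ⟨h1, h2⟩
    · cases hd : (e (k + 1 + j)).done
      · exact Or.inl ⟨A, M ++ new, by simp [h1], h2, by simp [hM, hnew], by simpa using h3⟩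
      · rcases A with _ | ⟨a, A⟩
        · refine Or.inr ⟨by simp [h1, hnew, hM], ?_⟩
          simp at h3 ⊢
          omega
        · refine Or.inl ⟨A, M ++ new, by simp [h1], fun b hb => h2 b (by simp [hb]),
            by simp [hM, hnew], ?_⟩
          simp at h3 ⊢
          omega
    · refine Or.inr ⟨?_, by omega⟩
      rw [List.mem_append, not_or]
      refine ⟨?_, hnew⟩
      split_ifs
      · exact fun hc => h1 (List.mem_of_mem_tail hc)
      · exact h1

/-- The label `k + 1` is not yet present during slot `k`, so the delay is at least 1 and the index
can be shifted by one. -/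
theorem delay_le_iff (s : ℕ → State m n₁ n₂ l N₁ N₂) (e : ℕ → Slot) (k n : ℕ) :
    delay s e k ≤ n ↔ ∃ j < n, completes s e (k + 1 + j) (k + 1) := by
  have h0 : ∀ i, completes s e (k + i) (k + 1) → i ≠ 0 := by
    rintro i hi rfl
    have := le_of_mem_contents (Or.inr (List.mem_of_mem_head? hi.2))
    omega
  constructor
  · intro h
    have h' : delay s e k < (n + 1 : ℕ) := lt_of_le_of_lt h (by exact_mod_cast Nat.lt_succ_self n)
    simp only [delay, iInf_lt_iff] at h'
    obtain ⟨i, hi, hlt⟩ := h'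
    have hlt : i < n + 1 := by exact_mod_cast hlt
    obtain ⟨j, rfl⟩ := Nat.exists_eq_succ_of_ne_zero (h0 i hi)
    refine ⟨j, by omega, ?_⟩
    rwa [Nat.add_assoc, Nat.add_comm 1]
  · rintro ⟨j, hj, hc⟩
    refine iInf₂_le_of_le (j + 1) ?_ (by exact_mod_cast hj)
    rwa [Nat.add_comm j, ← Nat.add_assoc]

/-- The task that enters in slot `k` leaves when as many computations have completed as there were
tasks in the system just after its entry. -/
theorem delay_le_iff_doneCount {Q : Params m n₁ n₂ l} {s : ℕ → State m n₁ n₂ l N₁ N₂}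
    {e : ℕ → Slot} (h : Q.IsPath s e) {k : ℕ} (hk : enters (s k) (e k) = true) (n : ℕ) :
    delay s e k ≤ n ↔ ((s (k + 1)).i₁ : ℕ) + (s (k + 1)).i₂ ≤ doneCount e (k + 1) n := by
  -- The task leaves in precisely the slot in which the count of completions crosses the threshold.
  have hc : ∀ j, completes s e (k + 1 + j) (k + 1) ↔
      doneCount e (k + 1) j < ((s (k + 1)).i₁ : ℕ) + (s (k + 1)).i₂ ∧
      ((s (k + 1)).i₁ : ℕ) + (s (k + 1)).i₂ ≤ doneCount e (k + 1) (j + 1) := by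
    intro j
    obtain ⟨-, hl, -, -⟩ := step_ne_zero (h (k + 1 + j))
    rw [← (length_contents h _).2] at hl
    have hh : completes s e (k + 1 + j) (k + 1) ↔
        (e (k + 1 + j)).done = true ∧ (tasks s e (k + 1 + j)).head? = some (k + 1) := by
      refine and_congr_right fun hd => ?_
      rw [hd, Bool.toNat_true] at hl
      rw [tasks, List.head?_append_of_ne_nil _ (List.length_pos_iff.1 hl)]
    rw [hh, doneCount_succ]
    rcases tasks_of_enters h hk j with ⟨A, M, h1, h2, -, h3⟩ | ⟨h1, h2⟩
    · rw [h1]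
      rcases A with _ | ⟨a, A⟩
      · simp at h3
        cases (e (k + 1 + j)).done
        · simp
        · simp
          omega
      · have := h2 a (by simp)
        simp at h3 ⊢
        constructor
        · omega
        · have := Bool.toNat_le (e (k + 1 + j)).done
          omega
    · constructor
      · rintro ⟨-, hd⟩
        exact absurd (List.mem_of_mem_head? hd) h1
      · omega
  rw [delay_le_iff]
  simp only [hc]
  -- The entering task itself is counted; this excludes a delay of 0.
  have hpos : 0 < ((s (k + 1)).i₁ : ℕ) + (s (k + 1)).i₂ := by
    obtain ⟨h1, -, h3, -⟩ := step_ne_zero (h k)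
    rw [hk, Bool.toNat_true] at h3
    omega
  induction n with
  | zero =>
    simp only [doneCount, Finset.range_zero, Finset.sum_empty, Nat.not_lt_zero, false_and,
      exists_false, false_iff]
    omega
  | succ n ih =>
    rw [doneCount_succ]
    constructor
    · rintro ⟨j, hj, h1, h2⟩
      rcases Nat.lt_succ_iff_lt_or_eq.1 hj with hj | rfl
      · exact (ih.1 ⟨j, hj, h1, h2⟩).trans (Nat.le_add_right _ _)
      · rwa [doneCount_succ] at h2
    · intro hle
      by_cases hn : ((s (k + 1)).i₁ : ℕ) + (s (k + 1)).i₂ ≤ doneCount e (k + 1) n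
      · obtain ⟨j, hj, h1⟩ := ih.2 hn
        exact ⟨j, hj.trans (Nat.lt_succ_self n), h1⟩
      · exact ⟨n, Nat.lt_succ_self n, not_le.1 hn, by rwa [doneCount_succ]⟩

/-! ### The Markov property and the joint law of entry and delay -/

section Markov

open MeasureTheory

/-- Only the pieces of the partition have to be measurable, so `A` can be any event. -/
theorem measureReal_eq_sum {Ω β : Type*} [MeasurableSpace Ω] (μ : Measure Ω) [IsFiniteMeasure μ]
    [Fintype β] {Y : Ω → β} (hY : ∀ y, MeasurableSet {ω | Y ω = y}) (A : Set Ω) :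
    μ.real A = ∑ y, μ.real {ω | ω ∈ A ∧ Y ω = y} := by
  have h := sum_measureReal_preimage_singleton (μ := μ.restrict A) (f := Y) Finset.univ
    (fun y _ => hY y)
  simp only [Finset.coe_univ, Set.preimage_univ, measureReal_restrict_apply MeasurableSet.univ,
    Set.univ_inter] at h
  rw [← h]
  refine Finset.sum_congr rfl fun y _ => ?_
  have hy : MeasurableSet (Y ⁻¹' {y}) := hY y
  rw [measureReal_restrict_apply hy, Set.inter_comm]
  rfl

theorem measureReal_eq_zero_of_forall_notMem {Ω : Type*} [MeasurableSpace Ω] (μ : Measure Ω)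
    {A : Set Ω} (hA : ∀ ω, ω ∉ A) : μ.real A = 0 := by
  rw [Set.eq_empty_of_forall_notMem hA, measureReal_empty]

/-- A property of trajectories that is determined by the history up to time `t_j`. -/
def IsHistory (j : ℕ) (C : (ℕ → State m n₁ n₂ l N₁ N₂) → (ℕ → Slot) → Prop) : Prop :=
  ∀ s e s' e', (∀ i ≤ j, s i = s' i) → (∀ i < j, e i = e' i) → (C s e ↔ C s' e')

theorem IsHistory.mono {i j : ℕ} (hij : i ≤ j)
    {C : (ℕ → State m n₁ n₂ l N₁ N₂) → (ℕ → Slot) → Prop} (hC : IsHistory i C) :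
    IsHistory j C := fun _ _ _ _ h1 h2 =>
  hC _ _ _ _ (fun a ha => h1 a (ha.trans hij)) (fun a ha => h2 a (ha.trans_le hij))

section Realization

variable {Q : Params m n₁ n₂ l} {x : State m n₁ n₂ l N₁ N₂ → ℝ} {Ω : Type*}
  {X : ℕ → Ω → State m n₁ n₂ l N₁ N₂} {E : ℕ → Ω → Slot}

/-- The history up to time `t_j`. -/
def history (X : ℕ → Ω → State m n₁ n₂ l N₁ N₂) (E : ℕ → Ω → Slot) (j : ℕ) (ω : Ω) :
    (Fin (j + 1) → State m n₁ n₂ l N₁ N₂) × (Fin j → Slot) :=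
  (fun i => X i ω, fun i => E i ω)

theorem history_eq_iff {j : ℕ} {ω : Ω} {y} : history X E j ω = y ↔
    (∀ i : Fin (j + 1), X i ω = y.1 i) ∧ ∀ i : Fin j, E i ω = y.2 i := by
  rw [Prod.ext_iff, funext_iff, funext_iff]
  rfl

variable [MeasurableSpace Ω] {μ : Measure Ω}

theorem Params.IsRealization.measurableSet_history (h : Q.IsRealization x μ X E) (j : ℕ) (y) :
    MeasurableSet {ω | history X E j ω = y} := by
  simp only [history_eq_iff, Set.ofPred_and, Set.ofPred_forall]
  exact (MeasurableSet.iInter fun i : Fin (j + 1) => h.measurable_state i (y.1 i)).inter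
    (MeasurableSet.iInter fun i : Fin j => h.measurable_slot i (y.2 i))

theorem Params.IsRealization.measurableSet (h : Q.IsRealization x μ X E) {j : ℕ}
    {C : (ℕ → State m n₁ n₂ l N₁ N₂) → (ℕ → Slot) → Prop} (hC : IsHistory j C) :
    MeasurableSet {ω | C (fun i => X i ω) (fun i => E i ω)} := by
  have : {ω | C (fun i => X i ω) (fun i => E i ω)} =
      ⋃ y ∈ {y | ∃ ω, history X E j ω = y ∧ C (fun i => X i ω) (fun i => E i ω)},
        {ω | history X E j ω = y} := by
    ext ω
    simp only [Set.mem_ofPred_eq, Set.mem_iUnion, exists_prop]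
    constructor
    · exact fun hω => ⟨_, ⟨ω, rfl, hω⟩, rfl⟩
    · rintro ⟨_, ⟨ω', rfl, hω'⟩, hy⟩
      rw [history_eq_iff] at hy
      exact (hC _ _ _ _ (fun i hi => hy.1 ⟨i, Nat.lt_succ_of_le hi⟩)
        (fun i hi => hy.2 ⟨i, hi⟩)).2 hω'
  rw [this]
  exact (Set.toFinite _).measurableSet_biUnion fun y _ => h.measurableSet_history j y

/-- The Markov property. -/
theorem Params.IsRealization.markov [IsProbabilityMeasure μ] (h : Q.IsRealization x μ X E) {j : ℕ}
    {C : (ℕ → State m n₁ n₂ l N₁ N₂) → (ℕ → Slot) → Prop} (hC : IsHistory j C)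
    (s : State m n₁ n₂ l N₁ N₂) (e : Slot) (s' : State m n₁ n₂ l N₁ N₂) :
    μ.real {ω | C (fun i => X i ω) (fun i => E i ω) ∧ X j ω = s ∧ E j ω = e ∧ X (j + 1) ω = s'} =
      μ.real {ω | C (fun i => X i ω) (fun i => E i ω) ∧ X j ω = s} * Q.step s e s' := by
  rw [measureReal_eq_sum μ (h.measurableSet_history j),
    measureReal_eq_sum μ (h.measurableSet_history j) {ω | C _ _ ∧ X j ω = s}, Finset.sum_mul]
  refine Finset.sum_congr rfl fun y _ => ?_
  -- The history `y` is continued by `e` and `s'`, so that `law` applies to the same sequences at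
  -- both horizons `j` and `j + 1`.
  let σ : ℕ → State m n₁ n₂ l N₁ N₂ := fun i => if hi : i < j + 1 then y.1 ⟨i, hi⟩ else s'
  let ε : ℕ → Slot := fun i => if hi : i < j then y.2 ⟨i, hi⟩ else e
  have hσ : σ (j + 1) = s' := by simp [σ]
  have hε : ε j = e := by simp [ε]
  have hist : ∀ ω, history X E j ω = y ↔ (∀ i ≤ j, X i ω = σ i) ∧ ∀ i < j, E i ω = ε i := by
    intro ω
    rw [history_eq_iff]
    refine and_congr ⟨fun H i hi => ?_, fun H i => ?_⟩ ⟨fun H i hi => ?_, fun H i => ?_⟩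
    · rw [H ⟨i, Nat.lt_succ_of_le hi⟩]
      simp only [σ, dif_pos (Nat.lt_succ_of_le hi)]
    · rw [H i (Nat.le_of_lt_succ i.2)]
      exact dif_pos i.2
    · rw [H ⟨i, hi⟩]
      simp [ε, hi]
    · rw [H i i.2]
      simp [ε]
  by_cases hc : C σ ε ∧ σ j = s
  · have e1 : {ω | ω ∈ {ω | C (fun i => X i ω) (fun i => E i ω) ∧ X j ω = s} ∧
        history X E j ω = y} = {ω | (∀ i ≤ j, X i ω = σ i) ∧ ∀ i < j, E i ω = ε i} := by
      ext ω
      simp only [Set.mem_ofPred_eq, hist]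
      refine ⟨fun H => H.2, fun H => ⟨⟨(hC _ _ _ _ H.1 H.2).2 hc.1, ?_⟩, H⟩⟩
      rw [H.1 j le_rfl, hc.2]
    have e2 : {ω | ω ∈ {ω | C (fun i => X i ω) (fun i => E i ω) ∧ X j ω = s ∧ E j ω = e ∧
        X (j + 1) ω = s'} ∧ history X E j ω = y} =
        {ω | (∀ i ≤ j + 1, X i ω = σ i) ∧ ∀ i < j + 1, E i ω = ε i} := by
      ext ω
      simp only [Set.mem_ofPred_eq, hist]
      constructor
      · rintro ⟨⟨-, -, H1, H2⟩, H3, H4⟩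
        refine ⟨fun i hi => ?_, fun i hi => ?_⟩
        · rcases Nat.lt_or_eq_of_le hi with hi | rfl
          · exact H3 i (Nat.le_of_lt_succ hi)
          · rw [H2, hσ]
        · rcases Nat.lt_succ_iff_lt_or_eq.1 hi with hi | rfl
          · exact H4 i hi
          · rw [H1, hε]
      · rintro ⟨H1, H2⟩
        have H3 : ∀ i ≤ j, X i ω = σ i := fun i hi => H1 i (Nat.le_succ_of_le hi)
        have H4 : ∀ i < j, E i ω = ε i := fun i hi => H2 i (Nat.lt_succ_of_lt hi)
        exact ⟨⟨(hC _ _ _ _ H3 H4).2 hc.1, by rw [H3 j le_rfl, hc.2],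
          by rw [H2 j (Nat.lt_succ_self j), hε], by rw [H1 (j + 1) le_rfl, hσ]⟩, H3, H4⟩
    rw [e1, e2, h.law, h.law, Finset.prod_range_succ, hσ, hε, hc.2, mul_assoc]
  · have e1 : {ω | ω ∈ {ω | C (fun i => X i ω) (fun i => E i ω) ∧ X j ω = s} ∧
        history X E j ω = y} = ∅ := by
      ext ω
      simp only [Set.mem_ofPred_eq, hist, Set.mem_empty_iff_false, iff_false]
      rintro ⟨⟨H1, H2⟩, H3, H4⟩
      exact hc ⟨(hC _ _ _ _ H3 H4).1 H1, by rw [← H3 j le_rfl, H2]⟩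
    have e2 : {ω | ω ∈ {ω | C (fun i => X i ω) (fun i => E i ω) ∧ X j ω = s ∧ E j ω = e ∧
        X (j + 1) ω = s'} ∧ history X E j ω = y} = ∅ := by
      refine Set.eq_empty_of_subset_empty (e1 ▸ ?_)
      rintro ω ⟨⟨H1, H2, -, -⟩, H3⟩
      exact ⟨⟨H1, H2⟩, H3⟩
    rw [e1, e2, measureReal_empty, zero_mul]

theorem Params.IsRealization.measurableSet_slot_state (h : Q.IsRealization x μ X E) (i j : ℕ)
    (y : Slot × State m n₁ n₂ l N₁ N₂) : MeasurableSet {ω | (E i ω, X j ω) = y} := by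
  simp only [Prod.ext_iff, Set.ofPred_and]
  exact (h.measurable_slot i _).inter (h.measurable_state j _)

/-- Induction on `n` for all histories at once: the first slot is absorbed into the history
property, and the rest is the same statement one time step later. -/
theorem Params.IsRealization.markov_doneCount [IsProbabilityMeasure μ]
    (h : Q.IsRealization x μ X E) (n : ℕ) {j : ℕ}
    {C : (ℕ → State m n₁ n₂ l N₁ N₂) → (ℕ → Slot) → Prop} (hC : IsHistory j C)
    (s : State m n₁ n₂ l N₁ N₂) (r : ℕ) :
    μ.real {ω | C (fun i => X i ω) (fun i => E i ω) ∧ X j ω = s ∧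
        r ≤ doneCount (fun i => E i ω) j n} =
      μ.real {ω | C (fun i => X i ω) (fun i => E i ω) ∧ X j ω = s} * Q.doneAtLeast n s r := by
  induction n generalizing j C s r with
  | zero =>
    rcases Nat.eq_zero_or_pos r with rfl | hr
    · simp [doneCount, Params.doneAtLeast]
    · simp [doneCount, Params.doneAtLeast, hr.ne']
  | succ n ih =>
    rw [measureReal_eq_sum μ (h.measurableSet_slot_state j (j + 1)), Params.doneAtLeast,
      Fintype.sum_prod_type, Finset.mul_sum]
    refine Finset.sum_congr rfl fun e _ => ?_
    rw [Finset.mul_sum]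
    refine Finset.sum_congr rfl fun s' _ => ?_
    have hC' : IsHistory (j + 1) fun σ ε => C σ ε ∧ σ j = s ∧ ε j = e := by
      intro σ ε σ' ε' h1 h2
      beta_reduce
      rw [h1 j (Nat.le_succ j), h2 j (Nat.lt_succ_self j), hC.mono (Nat.le_succ j) _ _ _ _ h1 h2]
    have e1 := ih hC' s' (r - e.done.toNat)
    have e2 := h.markov hC s e s'
    simp only [and_assoc] at e1
    rw [e2, mul_assoc] at e1
    rw [← e1]
    congr 1
    ext ω
    simp only [Set.mem_ofPred_eq, Prod.mk.injEq, doneCount_succ']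
    constructor
    · rintro ⟨⟨H1, H2, H3⟩, rfl, H5⟩
      exact ⟨H1, H2, rfl, H5, by omega⟩
    · rintro ⟨H1, H2, rfl, H5, H6⟩
      exact ⟨⟨H1, H2, by omega⟩, rfl, H5⟩

theorem isHistory_true (j : ℕ) :
    IsHistory j fun (_ : ℕ → State m n₁ n₂ l N₁ N₂) (_ : ℕ → Slot) => True :=
  fun _ _ _ _ _ _ => Iff.rfl

theorem Params.IsRealization.measurableSet_state_slot (h : Q.IsRealization x μ X E) (i j : ℕ)
    (y : State m n₁ n₂ l N₁ N₂ × Slot) : MeasurableSet {ω | (X i ω, E j ω) = y} := by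
  simp only [Prod.ext_iff, Set.ofPred_and]
  exact (h.measurable_state i _).inter (h.measurable_slot j _)

theorem Params.IsRealization.law_state [IsProbabilityMeasure μ] (h : Q.IsRealization x μ X E)
    (hx : Q.IsStationary x) (k : ℕ) (s : State m n₁ n₂ l N₁ N₂) :
    μ.real {ω | X k ω = s} = x s := by
  induction k generalizing s with
  | zero => simpa using h.law 0 (fun _ => s) (fun _ => ⟨false, false, false⟩)
  | succ k ih =>
    rw [measureReal_eq_sum μ (h.measurableSet_state_slot k k), Fintype.sum_prod_type]
    conv_rhs => rw [← hx.stationary]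
    simp only [Matrix.vecMul, dotProduct, Params.P, Finset.mul_sum]
    refine Finset.sum_congr rfl fun s₀ _ => Finset.sum_congr rfl fun e _ => ?_
    have := h.markov (isHistory_true k) s₀ e s
    simp only [true_and, ih] at this
    rw [← this]
    congr 1
    ext ω
    simp only [Set.mem_ofPred_eq, Prod.mk.injEq]
    tauto

theorem Params.IsRealization.law_step [IsProbabilityMeasure μ] (h : Q.IsRealization x μ X E)
    (hx : Q.IsStationary x) (k : ℕ) (s : State m n₁ n₂ l N₁ N₂) (e : Slot)
    (s' : State m n₁ n₂ l N₁ N₂) :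
    μ.real {ω | X k ω = s ∧ E k ω = e ∧ X (k + 1) ω = s'} = x s * Q.step s e s' := by
  have := h.markov (isHistory_true k) s e s'
  simpa only [true_and, h.law_state hx] using this

theorem Params.IsRealization.law_enters [IsProbabilityMeasure μ] (h : Q.IsRealization x μ X E)
    (hx : Q.IsStationary x) (k : ℕ) (s' : State m n₁ n₂ l N₁ N₂) :
    μ.real {ω | enters (X k ω) (E k ω) = true ∧ X (k + 1) ω = s'} =
      (x ᵥ* Q.Phat N₁ N₂) s' := by
  rw [measureReal_eq_sum μ (h.measurableSet_state_slot k k), Fintype.sum_prod_type]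
  simp only [Matrix.vecMul, dotProduct, Params.Phat, Finset.mul_sum]
  refine Finset.sum_congr rfl fun s₀ _ => Finset.sum_congr rfl fun e _ => ?_
  simp only [Set.mem_ofPred_eq, Prod.mk.injEq]
  split_ifs with he
  · rw [← h.law_step hx k]
    congr 1
    ext ω
    simp only [Set.mem_ofPred_eq]
    constructor
    · rintro ⟨⟨-, h2⟩, h3, h4⟩
      exact ⟨h3, h4, h2⟩
    · rintro ⟨rfl, rfl, h2⟩
      exact ⟨⟨he, h2⟩, rfl, rfl⟩
  · rw [mul_zero]
    refine measureReal_eq_zero_of_forall_notMem μ ?_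
    rintro ω ⟨⟨h1, -⟩, rfl, rfl⟩
    exact he h1

/-- This opens the combinatorics of trajectories to the random system, up to a null set. -/
theorem Params.IsRealization.ae_isPath [IsProbabilityMeasure μ] (h : Q.IsRealization x μ X E)
    (hx : Q.IsStationary x) : ∀ᵐ ω ∂μ, Q.IsPath (fun i => X i ω) (fun i => E i ω) := by
  unfold Params.IsPath
  rw [ae_all_iff]
  intro k
  rw [ae_iff, ← measureReal_eq_zero_iff, measureReal_eq_sum μ (h.measurableSet_state_slot k k)]
  refine Finset.sum_eq_zero fun y _ => ?_
  rw [measureReal_eq_sum μ (h.measurable_state (k + 1))]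
  refine Finset.sum_eq_zero fun s' _ => ?_
  by_cases hs : Q.step y.1 y.2 s' = 0
  · refine le_antisymm ?_ measureReal_nonneg
    rw [← mul_zero (x y.1), ← hs, ← h.law_step hx k]
    refine measureReal_mono ?_
    rintro ω ⟨⟨-, rfl⟩, h2⟩
    exact ⟨rfl, rfl, h2⟩
  · refine measureReal_eq_zero_of_forall_notMem μ ?_
    rintro ω ⟨⟨h1, rfl⟩, rfl⟩
    exact h1 hs

theorem isHistory_enters (k : ℕ) :
    IsHistory (k + 1) fun (s : ℕ → State m n₁ n₂ l N₁ N₂) (e : ℕ → Slot) =>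
      enters (s k) (e k) = true := by
  intro s e s' e' h1 h2
  beta_reduce
  rw [h1 k (Nat.le_succ k), h2 k (Nat.lt_succ_self k)]

theorem Params.IsRealization.law_enterEvent [IsProbabilityMeasure μ]
    (h : Q.IsRealization x μ X E) (hx : Q.IsStationary x) (k : ℕ) :
    μ.real (enterEvent X E k) = ∑ s, (x ᵥ* Q.Phat N₁ N₂) s := by
  rw [measureReal_eq_sum μ (h.measurable_state (k + 1))]
  exact Finset.sum_congr rfl fun s' _ => h.law_enters hx k s'

theorem Params.IsRealization.law_delay [IsProbabilityMeasure μ] (h : Q.IsRealization x μ X E)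
    (hx : Q.IsStationary x) (k n : ℕ) :
    μ.real (enterEvent X E k ∩ {ω | randomDelay X E k ω ≤ n}) =
      ∑ s, (x ᵥ* Q.Phat N₁ N₂) s * Q.doneAtLeast n s (s.i₁ + s.i₂) := by
  have e1 : μ.real (enterEvent X E k ∩ {ω | randomDelay X E k ω ≤ n}) =
      μ.real {ω | enters (X k ω) (E k ω) = true ∧
        ((X (k + 1) ω).i₁ : ℕ) + (X (k + 1) ω).i₂ ≤ doneCount (fun i => E i ω) (k + 1) n} := by
    refine measureReal_congr ?_
    filter_upwards [h.ae_isPath hx] with ω hω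
    refine propext (and_congr_right fun hk => ?_)
    exact delay_le_iff_doneCount hω hk n
  rw [e1, measureReal_eq_sum μ (h.measurable_state (k + 1))]
  refine Finset.sum_congr rfl fun s' _ => ?_
  rw [← h.law_enters hx k, ← h.markov_doneCount n (isHistory_enters k)]
  congr 1
  ext ω
  simp only [Set.mem_ofPred_eq]
  constructor
  · rintro ⟨⟨h1, h2⟩, rfl⟩
    exact ⟨h1, rfl, h2⟩
  · rintro ⟨h1, rfl, h2⟩
    exact ⟨⟨h1, h2⟩, rfl⟩

/-- Needed for the measurability of the events about the delay. -/
theorem isHistory_delay_le (k n : ℕ) :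
    IsHistory (k + 1 + n) fun (s : ℕ → State m n₁ n₂ l N₁ N₂) (e : ℕ → Slot) =>
      delay s e k ≤ n := by
  intro s e s' e' h1 h2
  have hc : ∀ j ≤ k + 1 + n, contents s e j = contents s' e' j := by
    intro j hj
    induction j with
    | zero => simp only [contents, h1 0 (Nat.zero_le _)]
    | succ j ih => simp only [contents, ih (by omega), h1 j (by omega), h2 j (by omega)]
  beta_reduce
  rw [delay_le_iff, delay_le_iff]
  refine exists_congr fun j => and_congr_right fun hj => ?_
  rw [completes, completes, hc _ (by omega), h2 _ (by omega)]

theorem Params.IsRealization.measurableSet_delay_le (h : Q.IsRealization x μ X E) (k n : ℕ) :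
    MeasurableSet {ω | randomDelay X E k ω ≤ n} :=
  h.measurableSet (isHistory_delay_le k n)

theorem Params.IsRealization.measurableSet_enterEvent (h : Q.IsRealization x μ X E) (k : ℕ) :
    MeasurableSet (enterEvent X E k) :=
  h.measurableSet (isHistory_enters k)

end Realization

end Markov

/-! ### Drift arguments and the positive entry rate -/

theorem DPH.IsValid.exit_nonneg {n : ℕ} {F : DPH n} (hF : F.IsValid) (j : Fin n) :
    0 ≤ F.exit j :=
  sub_nonneg.2 (hF.trans_sum j)

/-- The vector of mean absorption times. -/
theorem DPH.IsValid.exists_mean {n : ℕ} {F : DPH n} (hF : F.IsValid) :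
    ∃ h : Fin n → ℝ, ∀ j, ∑ j', F.trans j j' * h j' = h j - 1 := by
  obtain ⟨u, hu⟩ := hF.nonsing
  refine ⟨(↑u⁻¹ : Matrix (Fin n) (Fin n) ℝ) *ᵥ 1, fun j => ?_⟩
  have h : (1 - F.trans) *ᵥ ((↑u⁻¹ : Matrix (Fin n) (Fin n) ℝ) *ᵥ 1) = 1 := by
    rw [← hu, Matrix.mulVec_mulVec, Units.mul_inv, Matrix.one_mulVec]
  rw [Matrix.sub_mulVec, Matrix.one_mulVec] at h
  have hj := congrFun h j
  rw [Pi.sub_apply, Pi.one_apply] at hj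
  rw [← hj, sub_sub_cancel]
  rfl

section Nonneg

variable {Q : Params m n₁ n₂ l}

theorem start₁_nonneg (hQ : Q.IsValid) (full : Bool) (p) : 0 ≤ Q.start₁ full p := by
  rcases p with _ | j | j <;> cases full <;>
    simp [Params.start₁, hQ.vac.init_nonneg, hQ.tx.init_nonneg]

theorem start₂_nonneg (hQ : Q.IsValid) (p) : 0 ≤ Q.start₂ p := by
  rcases p with _ | j <;> simp [Params.start₂, hQ.comp.init_nonneg]

theorem server₁_nonneg (hQ : Q.IsValid) (full : Bool) (p b p') : 0 ≤ Q.server₁ full p b p' := by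
  have h1 := start₁_nonneg hQ full
  have h2 := hQ.tx.exit_nonneg
  have h3 := hQ.vac.exit_nonneg
  rcases p with _ | j | j <;> cases b <;> rcases p' with _ | j' | j' <;>
    simp only [Params.server₁, le_refl, h1]
  · exact add_nonneg (hQ.vac.trans_nonneg _ _) (mul_nonneg (h3 _) (h1 _))
  · exact mul_nonneg (h3 _) (h1 _)
  · exact hQ.tx.trans_nonneg _ _
  · exact mul_nonneg (h2 _) (h1 _)
  · exact mul_nonneg (h2 _) (h1 _)
  · exact mul_nonneg (h2 _) (h1 _)

theorem server₂_nonneg (hQ : Q.IsValid) (p d p') : 0 ≤ Q.server₂ p d p' := by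
  have h1 := start₂_nonneg hQ
  have h2 := hQ.comp.exit_nonneg
  rcases p with _ | j <;> cases d <;> rcases p' with _ | j' <;>
    simp only [Params.server₂, le_refl, h1]
  · exact hQ.comp.trans_nonneg _ _
  · exact mul_nonneg (h2 _) (h1 _)
  · exact mul_nonneg (h2 _) (h1 _)

theorem step_nonneg (hQ : Q.IsValid) (s : State m n₁ n₂ l N₁ N₂) (e : Slot)
    (s' : State m n₁ n₂ l N₁ N₂) : 0 ≤ Q.step s e s' := by
  have h : 0 ≤ (if e.arrival then Q.D₁ else Q.D₀) s.ph s'.ph := by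
    split_ifs
    · exact hQ.dmap.nonneg₁ _ _
    · exact hQ.dmap.nonneg₀ _ _
  rw [Params.step]
  refine ite_nonneg ?_ le_rfl
  exact mul_nonneg (mul_nonneg h (server₁_nonneg hQ _ _ _ _)) (server₂_nonneg hQ _ _ _)

end Nonneg

section Stationary

variable {Q : Params m n₁ n₂ l} {x : State m n₁ n₂ l N₁ N₂ → ℝ}

theorem Params.IsStationary.balance (hx : Q.IsStationary x) (f : State m n₁ n₂ l N₁ N₂ → ℝ) :
    ∑ s, x s * ∑ e, ∑ s', Q.step s e s' * f s' = ∑ s, x s * f s := by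
  conv_rhs => rw [← hx.stationary]
  simp only [Matrix.vecMul, dotProduct, Params.P, Finset.mul_sum, Finset.sum_mul]
  conv_rhs => rw [Finset.sum_comm]
  refine Finset.sum_congr rfl fun s _ => ?_
  rw [Finset.sum_comm]
  simp only [mul_assoc]

/-- A function that decreases by `g ≥ 0` on average is constant on average in the stationary
regime, so that `g` vanishes there. -/
theorem Params.IsStationary.eq_zero_of_drift (hx : Q.IsStationary x)
    {f g : State m n₁ n₂ l N₁ N₂ → ℝ} (hg : ∀ s, 0 ≤ g s)
    (h : ∀ s, x s ≠ 0 → ∑ e, ∑ s', Q.step s e s' * f s' = f s - g s)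
    (s : State m n₁ n₂ l N₁ N₂) (hs : x s ≠ 0) : g s = 0 := by
  have hb := hx.balance f
  have : ∑ s, x s * g s = 0 := by
    rw [← sub_eq_zero.2 hb.symm, ← Finset.sum_sub_distrib]
    refine Finset.sum_congr rfl fun s _ => ?_
    by_cases hs : x s = 0
    · simp [hs]
    · rw [h s hs]
      ring
  rw [Finset.sum_eq_zero_iff_of_nonneg fun s _ => mul_nonneg (hx.nonneg s) (hg s)] at this
  exact (mul_eq_zero.1 (this s (Finset.mem_univ s))).resolve_left hs

theorem sum_step_mul (Q : Params m n₁ n₂ l) (s : State m n₁ n₂ l N₁ N₂) (e : Slot)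
    (f : Option (Fin l ⊕ Fin n₁) → ℝ) (g : Option (Fin n₂) → ℝ) :
    ∑ s', Q.step s e s' * (f s'.p₁ * g s'.p₂) = (∑ h, Q.arr e.arrival s.ph h) *
      (∑ p, Q.kernel₁ (decide (next₁ s e = 0)) (decide (next₂ s.i₂ e.sent e.done = N₂))
          s.p₁ e.sent p * f p) *
      ∑ p, Q.kernel₂ (decide (next₂ s.i₂ e.sent e.done = 0)) s.p₂ e.done p * g p := by
  rw [sum_step Q s e fun _ p₁ p₂ => f p₁ * g p₂]
  exact sum_mul_triple _ _ _ fun _ _ _ => by ring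

theorem sum_step_indicator_eq_zero (hQ : Q.IsValid) {s : State m n₁ n₂ l N₁ N₂} {c : Slot → ℝ}
    (hc : ∀ e, 0 ≤ c e) (h : ∑ e, ∑ s', Q.step s e s' * c e = 0) {e : Slot} (he : c e ≠ 0)
    (s' : State m n₁ n₂ l N₁ N₂) : Q.step s e s' = 0 := by
  rw [Finset.sum_eq_zero_iff_of_nonneg fun e _ => Finset.sum_nonneg fun s' _ =>
    mul_nonneg (step_nonneg hQ _ _ _) (hc e)] at h
  have h := h e (Finset.mem_univ e)
  rw [Finset.sum_eq_zero_iff_of_nonneg fun s' _ => mul_nonneg (step_nonneg hQ _ _ _) (hc e)] at h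
  exact (mul_eq_zero.1 (h s' (Finset.mem_univ s'))).resolve_right he

/-- If all transitions of positive probability change `f` by `- c`, then `c` vanishes. -/
theorem Params.IsStationary.step_eq_zero (hQ : Q.IsValid) (hx : Q.IsStationary x)
    {f : State m n₁ n₂ l N₁ N₂ → ℝ} {c : Slot → ℝ} (hc : ∀ e, 0 ≤ c e)
    (h : ∀ s e s', x s ≠ 0 → Q.step s e s' ≠ 0 → f s' = f s - c e)
    {s : State m n₁ n₂ l N₁ N₂} (hs : x s ≠ 0) {e : Slot} (he : c e ≠ 0)
    (s' : State m n₁ n₂ l N₁ N₂) : Q.step s e s' = 0 := by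
  refine sum_step_indicator_eq_zero hQ hc
    (hx.eq_zero_of_drift (f := f) (g := fun s => ∑ e, ∑ s', Q.step s e s' * c e)
      (fun s => Finset.sum_nonneg fun e _ => Finset.sum_nonneg fun s' _ =>
        mul_nonneg (step_nonneg hQ _ _ _) (hc e)) (fun s hs => ?_) s hs) he s'
  rw [← one_mul (f s), ← sum_step_eq_one hQ.isStoch s, Finset.sum_mul, ← Finset.sum_sub_distrib]
  refine Finset.sum_congr rfl fun e _ => ?_
  rw [Finset.sum_mul, ← Finset.sum_sub_distrib]
  refine Finset.sum_congr rfl fun s' _ => ?_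
  by_cases h0 : Q.step s e s' = 0
  · simp [h0]
  · rw [h s e s' hs h0]
    ring

/-- If server 2 never completes a computation and no task arrives there, then it is idle. -/
theorem Params.IsStationary.p₂_eq_none (hQ : Q.IsValid) (hx : Q.IsStationary x)
    (hsent : ∀ s e s', x s ≠ 0 → e.sent = true → Q.step s e s' = 0)
    (hdone : ∀ s e s', x s ≠ 0 → e.done = true → Q.step s e s' = 0)
    {s : State m n₁ n₂ l N₁ N₂} (hs : x s ≠ 0) : s.p₂ = none := by
  obtain ⟨h, hh⟩ := hQ.comp.exists_mean
  -- Mean remaining computation time: with no completions and no new work it drifts down by 1 while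
  -- the server is busy.
  let φ : Option (Fin n₂) → ℝ := fun p => p.elim 0 h
  have key := hx.eq_zero_of_drift (f := fun s => φ s.p₂)
    (g := fun s => if s.p₂ = none then 0 else 1) (fun s => by split_ifs <;> norm_num)
    (fun s hs => ?_) s hs
  · by_contra hc
    simp [hc] at key
  cases hp : s.p₂ with
  | none =>
    simp only [if_true, φ, Option.elim_none, sub_zero]
    refine Finset.sum_eq_zero fun e _ => Finset.sum_eq_zero fun s' _ => ?_
    by_cases h0 : Q.step s e s' = 0
    · rw [h0, zero_mul]
    · have h1 : e.sent = false := by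
        by_contra hc
        exact h0 (hsent s e s' hs (by simpa using hc))
      have h2 := (step_ne_zero h0).2.2.2
      have h3 : ¬ 0 < (s.i₂ : ℕ) := fun h => i₂_pos.2 h hp
      have h4 : s'.p₂ = none := by
        by_contra hc
        have := i₂_pos.1 hc
        rw [h1, Bool.toNat_false] at h2
        omega
      rw [h4, Option.elim_none, mul_zero]
  | some j =>
    have hp' : s.p₂ ≠ none := by simp [hp]
    have hk : ∑ p, Q.kernel₂ false (some j) false p * φ p = h j - 1 := by
      rw [← hh j]
      simp [Fintype.sum_option, Params.kernel₂, Params.server₂, φ]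
    have he : ∀ e : Slot, ∑ s', Q.step s e s' * φ s'.p₂ =
        if e.done then 0
        else (∑ h, Q.arr e.arrival s.ph h) * Q.sendProb s.p₁ e.sent * (h j - 1) := by
      intro e
      split_ifs with hd
      · exact Finset.sum_eq_zero fun s' _ => by rw [hdone s e s' hs hd, zero_mul]
      · have hd : e.done = false := by simpa using hd
        have := sum_step_mul Q s e (fun _ => 1) φ
        simp only [one_mul, mul_one] at this
        rw [this, next₂_idle hp' hd, hd, hp, hk, sum_kernel₁ hQ.isStoch.tx hQ.isStoch.vac _ _ _ _
          (fun h hs => next₁_idle h hs)]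
    simp only [he, sum_slot, Fintype.sum_bool (fun c => if c = true then (0 : ℝ) else _), if_true,
      Bool.false_eq_true, if_false, zero_add, ← Finset.sum_mul, ← Finset.mul_sum, sum_sendProb,
      hQ.isStoch.arr, one_mul, mul_one, reduceCtorEq]
    rfl

/-- If server 1 never completes a transmission, queue 2 is empty and no task enters queue 1, then
server 1 is idle. -/
theorem Params.IsStationary.p₁_eq_none (hQ : Q.IsValid) (hx : Q.IsStationary x) (hN : 0 < N₂)
    (hent : ∀ s e s', x s ≠ 0 → enters s e = true → Q.step s e s' = 0)
    (hsent : ∀ s e s', x s ≠ 0 → e.sent = true → Q.step s e s' = 0)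
    (hp₂ : ∀ s, x s ≠ 0 → s.p₂ = none)
    {s : State m n₁ n₂ l N₁ N₂} (hs : x s ≠ 0) : s.p₁ = none := by
  obtain ⟨h, hh⟩ := hQ.tx.exists_mean
  obtain ⟨v, hv⟩ := hQ.vac.exists_mean
  let c : ℝ := ∑ j, Q.tx.init j * h j
  -- Mean remaining time to the end of a transmission. A vacation adds the mean `c` of a fresh one:
  -- queue 2 is empty, hence not full, so a transmission follows.
  let ψ : Fin l ⊕ Fin n₁ → ℝ := Sum.elim (fun j => v j + c) h
  let φ : Option (Fin l ⊕ Fin n₁) → ℝ := fun p => p.elim 0 ψ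
  have key := hx.eq_zero_of_drift (f := fun s => φ s.p₁)
    (g := fun s => if s.p₁ = none then 0 else 1) (fun s => by split_ifs <;> norm_num)
    (fun s hs => ?_) s hs
  · by_contra hc
    simp [hc] at key
  cases hp : s.p₁ with
  | none =>
    simp only [if_true, φ, Option.elim_none, sub_zero]
    refine Finset.sum_eq_zero fun e _ => Finset.sum_eq_zero fun s' _ => ?_
    by_cases h0 : Q.step s e s' = 0
    · rw [h0, zero_mul]
    · have h1 : enters s e = false := by
        by_contra hc
        exact h0 (hent s e s' hs (by simpa using hc))
      have h2 := (step_ne_zero h0).2.2.1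
      have h3 : ¬ 0 < (s.i₁ : ℕ) := fun h => i₁_pos.2 h hp
      have h4 : s'.p₁ = none := by
        by_contra hc
        have := i₁_pos.1 hc
        rw [h1, Bool.toNat_false] at h2
        omega
      rw [h4, Option.elim_none, mul_zero]
  | some q =>
    have hp' : s.p₁ ≠ none := by simp [hp]
    have hk : ∑ p, Q.kernel₁ false false (some q) false p * φ p = ψ q - 1 := by
      rcases q with j | j
      · have h1 : ∑ j', Q.vac.trans j j' * (v j' + c) =
            v j - 1 + (1 - Q.vac.exit j) * c := by
          simp only [mul_add, Finset.sum_add_distrib, hv, ← Finset.sum_mul]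
          simp [DPH.exit]
        have h2 : ∑ j', Q.vac.exit j * Q.tx.init j' * h j' = Q.vac.exit j * c := by
          simp only [mul_assoc, ← Finset.mul_sum, c]
        simp [Fintype.sum_option, Params.kernel₁, Params.server₁, Params.start₁, φ, ψ, h1, h2]
        ring
      · simp [Fintype.sum_option, Params.kernel₁, Params.server₁, φ, ψ, hh]
    have he : ∀ e : Slot, ∑ s', Q.step s e s' * φ s'.p₁ =
        if e.sent then 0
        else (∑ h, Q.arr e.arrival s.ph h) * (ψ q - 1) * Q.doneProb s.p₂ e.done := by
      intro e
      split_ifs with hd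
      · exact Finset.sum_eq_zero fun s' _ => by rw [hsent s e s' hs hd, zero_mul]
      · have hd : e.sent = false := by simpa using hd
        have h2 : ¬ 0 < (s.i₂ : ℕ) := fun h => i₂_pos.2 h (hp₂ s hs)
        have hf : ¬ next₂ s.i₂ e.sent e.done = N₂ := by
          rw [hd, next₂, Bool.toNat_false]
          omega
        have := sum_step_mul Q s e φ (fun _ => 1)
        simp only [mul_one] at this
        rw [this, next₁_idle hp' hd, decide_eq_false hf, hd, hp, hk,
          sum_kernel₂ hQ.isStoch.comp _ _ _ (fun h hs => next₂_idle h hs)]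
    simp only [he, sum_slot]
    simp only [Fintype.sum_bool (fun b => ∑ d, if b = true then (0 : ℝ) else _), if_true,
      Bool.false_eq_true, if_false, zero_add, ← Finset.sum_mul, ← Finset.mul_sum, sum_doneProb,
      hQ.isStoch.arr, one_mul, mul_one, reduceCtorEq, Finset.sum_const_zero]
    rfl

/-- Tasks enter queue 1 at a positive rate. -/
theorem Params.IsStationary.sum_Phat_pos (hQ : Q.IsValid) (hx : Q.IsStationary x) (hN₁ : 0 < N₁)
    (hN₂ : 0 < N₂) : 0 < ∑ s, (x ᵥ* Q.Phat N₁ N₂) s := by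
  have hnn : ∀ s s', 0 ≤ x s * Q.Phat N₁ N₂ s s' := fun s s' =>
    mul_nonneg (hx.nonneg s) (Finset.sum_nonneg fun e _ => ite_nonneg (step_nonneg hQ _ _ _) le_rfl)
  refine lt_of_le_of_ne (Finset.sum_nonneg fun s' _ => Finset.sum_nonneg fun s _ => hnn s s') ?_
  intro h0
  have hent : ∀ s e s', x s ≠ 0 → enters s e = true → Q.step s e s' = 0 := by
    intro s e s' hs he
    have h1 := (Finset.sum_eq_zero_iff_of_nonneg fun s' _ =>
      Finset.sum_nonneg fun s _ => hnn s s').1 h0.symm s' (Finset.mem_univ _)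
    have h2 := (Finset.sum_eq_zero_iff_of_nonneg fun s _ => hnn s s').1 h1 s (Finset.mem_univ _)
    have h3 := (mul_eq_zero.1 h2).resolve_left hs
    have h4 := (Finset.sum_eq_zero_iff_of_nonneg fun e _ =>
      ite_nonneg (step_nonneg hQ _ _ _) le_rfl).1 h3 e (Finset.mem_univ _)
    simpa [he] using h4
  -- Without entries, queue 1 changes only through transmissions, which shorten it.
  have hsent : ∀ s e s', x s ≠ 0 → e.sent = true → Q.step s e s' = 0 := by
    intro s e s' hs he
    refine hx.step_eq_zero hQ (f := fun s => ((s.i₁ : ℕ) : ℝ)) (c := fun e => (e.sent.toNat : ℝ))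
      (fun e => Nat.cast_nonneg _) (fun s e s' hs h => ?_) hs (by simp [he]) s'
    have h1 : enters s e = false := by
      by_contra hc
      exact h (hent s e s' hs (by simpa using hc))
    have h2 := (step_ne_zero h).2.2.1
    rw [h1, Bool.toNat_false, add_zero] at h2
    rw [← h2]
    push_cast
    ring
  have hdone : ∀ s e s', x s ≠ 0 → e.done = true → Q.step s e s' = 0 := by
    intro s e s' hs he
    refine hx.step_eq_zero hQ (f := fun s => ((s.i₂ : ℕ) : ℝ)) (c := fun e => (e.done.toNat : ℝ))
      (fun e => Nat.cast_nonneg _) (fun s e s' hs h => ?_) hs (by simp [he]) s'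
    have h1 : e.sent = false := by
      by_contra hc
      exact h (hsent s e s' hs (by simpa using hc))
    have h2 := (step_ne_zero h).2.2.2
    rw [h1, Bool.toNat_false, add_zero] at h2
    rw [← h2]
    push_cast
    ring
  have hp₂ : ∀ s, x s ≠ 0 → s.p₂ = none := fun s hs => hx.p₂_eq_none hQ hsent hdone hs
  have hp₁ : ∀ s, x s ≠ 0 → s.p₁ = none := fun s hs => hx.p₁_eq_none hQ hN₂ hent hsent hp₂ hs
  -- Queue 1 is empty and `N₁ > 0`, so a generated task could not be rejected.
  have harr : ∀ s e s', x s ≠ 0 → e.arrival = true → Q.step s e s' = 0 := by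
    intro s e s' hs he
    refine hent s e s' hs ?_
    have : ¬ 0 < (s.i₁ : ℕ) := fun h => i₁_pos.2 h (hp₁ s hs)
    have : (s.i₁ : ℕ) < N₁ := by omega
    simp [enters, he, this]
  -- The marginal of `x` on the arrival phase, which is stationary for `D₀ + D₁`.
  let π : Fin m → ℝ := fun i => ∑ s, if s.ph = i then x s else 0
  have hπ : ∀ f : Fin m → ℝ, ∑ i, π i * f i = ∑ s, x s * f s.ph := by
    intro f
    simp only [π, Finset.sum_mul]
    rw [Finset.sum_comm]
    refine Finset.sum_congr rfl fun s _ => ?_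
    simp
  have h1 : 0 < ∑ i, (π ᵥ* Q.D₁) i := by
    refine hQ.dmap.rate_pos π (fun i => Finset.sum_nonneg fun s _ =>
      ite_nonneg (hx.nonneg s) le_rfl) ?_ ?_
    · simpa [hx.sum_eq_one] using hπ fun _ => 1
    · funext j
      simp only [Matrix.vecMul, dotProduct]
      rw [hπ fun i => (Q.D₀ + Q.D₁) i j]
      have hb := hx.balance fun s => if s.ph = j then 1 else 0
      have ha : ∀ s : State m n₁ n₂ l N₁ N₂,
          ∑ e, ∑ s', Q.step s e s' * (if s'.ph = j then 1 else 0) = (Q.D₀ + Q.D₁) s.ph j := by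
        intro s
        rw [sum_step_arrival hQ.isStoch s fun _ h => if h = j then 1 else 0]
        simp [Params.arr, add_comm]
      simp only [ha] at hb
      rw [hb]
      simp [π]
  have h2 : ∑ i, (π ᵥ* Q.D₁) i = 0 := by
    simp only [Matrix.vecMul, dotProduct]
    rw [Finset.sum_comm]
    simp only [← Finset.mul_sum]
    rw [hπ fun i => ∑ j, Q.D₁ i j]
    refine Finset.sum_eq_zero fun s _ => ?_
    by_cases hs : x s = 0
    · rw [hs, zero_mul]
    · have ha := sum_step_arrival hQ.isStoch s fun a _ => if a then 1 else 0
      have hz : ∑ e, ∑ s', Q.step s e s' * (if e.arrival = true then 1 else 0) = 0 := by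
        refine Finset.sum_eq_zero fun e _ => Finset.sum_eq_zero fun s' _ => ?_
        split_ifs with he
        · rw [harr s e s' hs he, zero_mul]
        · rw [mul_zero]
      rw [hz] at ha
      have : ∑ j, Q.D₁ s.ph j = 0 := by
        rw [ha]
        simp [Params.arr]
      rw [this, mul_zero]
  exact absurd h2 h1.ne'

end Stationary

/-! ### The conditional law of the delay -/

theorem delayProb_le_zero {Ω : Type*} [MeasurableSpace Ω] (μ : MeasureTheory.Measure Ω)
    (X : ℕ → Ω → State m n₁ n₂ l N₁ N₂) (E : ℕ → Ω → Slot) (k : ℕ) :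
    delayProb μ X E k {t | t ≤ 0} = 0 := by
  refine measureReal_eq_zero_of_forall_notMem _ fun ω hω => ?_
  obtain ⟨j, hj, -⟩ := (delay_le_iff (fun i => X i ω) (fun i => E i ω) k 0).1 hω
  exact Nat.not_lt_zero j hj

/-- The normalizing constant of `z` is the probability of the conditioning event. -/
theorem Params.IsRealization.delayProb_le {Q : Params m n₁ n₂ l}
    {x : State m n₁ n₂ l N₁ N₂ → ℝ} {Ω : Type*} [MeasurableSpace Ω] {μ : MeasureTheory.Measure Ω}
    [MeasureTheory.IsProbabilityMeasure μ] {X : ℕ → Ω → State m n₁ n₂ l N₁ N₂} {E : ℕ → Ω → Slot}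
    (h : Q.IsRealization x μ X E) (hQ : Q.IsStoch) (hx : Q.IsStationary x) (k n : ℕ) :
    delayProb μ X E k {t | t ≤ n} = emptyMass (Q.xTilde x n) := by
  rw [delayProb, MeasureTheory.measureReal_def, ProbabilityTheory.cond_apply (h.measurableSet_enterEvent k),
    ENNReal.toReal_mul, ENNReal.toReal_inv]
  refine (congrArg (_ * ·) (h.law_delay hx k n)).trans ?_
  rw [← MeasureTheory.measureReal_def, h.law_enterEvent hx, emptyMass_xTilde, Finset.mul_sum]
  refine Finset.sum_congr rfl fun s _ => ?_
  rw [Params.z, Pi.smul_apply, smul_eq_mul, doneAtLeast_noArrivals hQ, mul_assoc]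

end TandemQueue

open TandemQueue in
theorem proposition1 {m n₁ n₂ l : ℕ} (Q : Params m n₁ n₂ l) (hQ : Q.IsValid)
    (N₁ N₂ : ℕ) (hN₁ : 1 ≤ N₁) (hN₂ : N₁ < N₂)
    (x : State m n₁ n₂ l N₁ N₂ → ℝ) (hx : Q.IsStationary x)
    {Ω : Type*} [MeasurableSpace Ω] (μ : MeasureTheory.Measure Ω)
    [MeasureTheory.IsProbabilityMeasure μ]
    (X : ℕ → Ω → State m n₁ n₂ l N₁ N₂) (E : ℕ → Ω → Slot)
    (hXE : Q.IsRealization x μ X E) (k : ℕ) :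
    0 < μ.real (enterEvent X E k) ∧
    delayProb μ X E k {t | t ≤ 0} = 0 ∧
    ∀ n : ℕ, 1 ≤ n →
      delayProb μ X E k {t | t ≤ n} = emptyMass (Q.xTilde x n) ∧
      delayProb μ X E k {t | t = n} =
        delayProb μ X E k {t | t ≤ n} - delayProb μ X E k {t | t ≤ (n - 1 : ℕ)} ∧
      delayProb μ X E k {t | t > n} = 1 - delayProb μ X E k {t | t ≤ n} := by
  have hpos : 0 < μ.real (enterEvent X E k) := by
    rw [hXE.law_enterEvent hx]
    exact hx.sum_Phat_pos hQ hN₁ (by omega)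
  have hprob : MeasureTheory.IsProbabilityMeasure (ProbabilityTheory.cond μ (enterEvent X E k)) :=
    ProbabilityTheory.cond_isProbabilityMeasure fun h => hpos.ne' (by
      rw [MeasureTheory.measureReal_def, h, ENNReal.toReal_zero])
  refine ⟨hpos, delayProb_le_zero μ X E k, fun n hn => ⟨hXE.delayProb_le hQ.isStoch hx k n, ?_, ?_⟩⟩
  · simp only [delayProb, Set.mem_ofPred_eq]
    rw [← MeasureTheory.measureReal_sdiff (fun ω hω => ?_) (hXE.measurableSet_delay_le k (n - 1))]
    · congr 1
      ext ω
      simp only [Set.mem_ofPred_eq, Set.mem_sdiff, not_le]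
      generalize randomDelay X E k ω = t
      induction t with
      | top => simp
      | coe t =>
        -- Here `1 ≤ n` matters: the truncated `n - 1` must be a true predecessor.
        norm_cast
        omega
    · exact le_trans (b := ((n - 1 : ℕ) : ℕ∞)) hω (by exact_mod_cast Nat.sub_le n 1)
  · simp only [delayProb, Set.mem_ofPred_eq]
    rw [← MeasureTheory.probReal_compl_eq_one_sub (hXE.measurableSet_delay_le k n)]
    congr 1
    ext ω
    simp only [Set.mem_ofPred_eq, Set.mem_compl_iff, not_le, gt_iff_lt]
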